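/- Let $K$ be an algebraically closed field and let $\Lambda$ be a finite-dimensional, basic, indecomposable, symmetric $K$-algebra. Fix a complete set $\{e_i\}$ of primitive orthogonal idempotents of $\Lambda$ (so that the right modules $P_i=e_i\Lambda$ are pairwise non-isomorphic), and let $Q$ be the Gabriel quiver of $\Lambda$: its vertices are the indices $i$, and the number of arrows $i\to j$ is $\dim_K e_i(\mathrm{rad}\,\Lambda/\mathrm{rad}^2\Lambda)e_j$. For a vertex $i$ let $i^+$ (respectively $i^-$) be the set of arrows starting (respectively ending) at $i$, and put $$P_i^+=\bigoplus_{(\alpha:\,i\to j)\in i^+}P_j,\qquad P_i^-=\bigoplus_{(\gamma:\,k\to i)\in i^-}P_k .$$ For a finite-dimensional right $\Lambda$-module $M$ let $\Omega(M)$ denote the kernel of a minimal projective cover of $M$; the $\Omega$-period of $M$ is the least $n\ge 1$ with $\Omega^n(M)\cong M$, if such an $n$ exists. Assume that every finite-dimensional indecomposable non-projective right $\Lambda$-module is periodic, with $\Omega$-period dividing $4$. Then the following are equivalent: (a) there is a simple right $\Lambda$-module $S$ such that $\Omega^2(S)$ is simple; (b) there is an arrow $\alpha: i\to j$ of $Q$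 with $i^+=\{\alpha\}=j^-$; (c) there is a vertex $i$ of $Q$ with $\dim_K P_i=\dim_K P_i^+=\dim_K P_i^-$. If these conditions hold, then $Q$ is either a single vertex with exactly one loop, or consists of exactly two vertices $i\ne j$ and exactly two arrows $i\to j$ and $j\to i$. Moreover, $\Lambda$ is then a Nakayama algebra (every indecomposable projective left or right $\Lambda$-module is uniserial) and has finite representation type (there are only finitely many isomorphism classes of finite-dimensional indecomposable right $\Lambda$-modules). -/

import Mathlib

open scoped DirectSum

universe u v w

noncomputable section

namespace RepFinSym

/-! ### Modules

The definitions of this part are for left modules over a ring `R`; right `Λ`-modules are modules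
over `Λᵐᵒᵖ`. -/

section Modules

variable (R : Type w) [Ring R]

/-- A module is indecomposable if it is nonzero and not an internal direct sum of two nonzero
submodules. -/
def IsIndecomposableModule (M : Type v) [AddCommGroup M] [Module R M] : Prop :=
  Nontrivial M ∧ ∀ A B : Submodule R M, IsCompl A B → A = ⊥ ∨ B = ⊥

/-- A module is uniserial if its submodules form a chain. -/
def IsUniserial (M : Type v) [AddCommGroup M] [Module R M] : Prop :=
  ∀ A B : Submodule R M, A ≤ B ∨ B ≤ A

variable {R} in
/-- A submodule `A` of `M` is superfluous (small) if `A + B = M` forces `B = M`. -/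
def IsSuperfluous {M : Type v} [AddCommGroup M] [Module R M] (A : Submodule R M) : Prop :=
  ∀ B : Submodule R M, A ⊔ B = ⊤ → B = ⊤

variable {R} in
/-- `f : P → M` is a (minimal) projective cover of `M`. -/
def IsProjectiveCover {P M : Type v} [AddCommGroup P] [Module R P] [AddCommGroup M] [Module R M]
    (f : P →ₗ[R] M) : Prop :=
  Module.Projective R P ∧ Function.Surjective f ∧ IsSuperfluous (LinearMap.ker f)

/-- `N` is isomorphic to the syzygy `Ω(M)`, the kernel of a projective cover of `M`. -/
def IsSyzygy (M N : Type v) [AddCommGroup M] [Module R M] [AddCommGroup N] [Module R N] : Prop :=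
  ∃ (P : Type v) (_ : AddCommGroup P) (_ : Module R P) (f : P →ₗ[R] M),
    IsProjectiveCover f ∧ Nonempty (N ≃ₗ[R] LinearMap.ker f)

/-- `N` is isomorphic to the `n`-th syzygy `Ωⁿ(M)`. -/
def IsNthSyzygy : ℕ → ∀ (M N : Type v) [AddCommGroup M] [Module R M] [AddCommGroup N]
    [Module R N], Prop
  | 0, M, N, _, _, _, _ => Nonempty (N ≃ₗ[R] M)
  | n + 1, M, N, _, _, _, _ => ∃ (L : Type v) (_ : AddCommGroup L) (_ : Module R L),
      IsSyzygy R M L ∧ IsNthSyzygy n L N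

/-- `M` is periodic of `Ω`-period `n`: `n` is the least positive integer with `Ωⁿ(M) ≅ M`. -/
def HasPeriod (M : Type v) [AddCommGroup M] [Module R M] (n : ℕ) : Prop :=
  IsLeast {k : ℕ | 1 ≤ k ∧ IsNthSyzygy R k M M} n

end Modules

/-- Every finitely generated indecomposable projective `R`-module is uniserial. -/
def IsSerial (R : Type v) [Ring R] : Prop :=
  ∀ (P : Type v) [AddCommGroup P] [Module R P], Module.Finite R P → Module.Projective R P →
    IsIndecomposableModule R P → IsUniserial R P

/-! ### Algebras -/

section Algebras

/-- A Nakayama algebra: left serial and right serial. -/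
def IsNakayama (Λ : Type v) [Ring Λ] : Prop :=
  IsSerial Λ ∧ IsSerial Λᵐᵒᵖ

/-- Finite representation type: there are only finitely many isomorphism classes of finitely
generated indecomposable right `Λ`-modules. -/
def HasFiniteType (Λ : Type v) [Ring Λ] : Prop :=
  ∃ (n : ℕ) (X : Fin n → ModuleCat.{v} Λᵐᵒᵖ),
    ∀ (M : Type v) [AddCommGroup M] [Module Λᵐᵒᵖ M], Module.Finite Λᵐᵒᵖ M →
      IsIndecomposableModule Λᵐᵒᵖ M → ∃ i, Nonempty (M ≃ₗ[Λᵐᵒᵖ] X i)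

/-- A ring is indecomposable (connected, a block) if it is nonzero and has no central idempotents
other than `0` and `1`, that is, if it is not a product of two nonzero rings. -/
def IsIndecomposableRing (Λ : Type v) [Ring Λ] : Prop :=
  Nontrivial Λ ∧ ∀ z ∈ Subring.center Λ, IsIdempotentElem z → z = 0 ∨ z = 1

/-- A finite-dimensional algebra is symmetric if it has a linear form `φ` such that
`(a, b) ↦ φ (a * b)` is a nondegenerate symmetric bilinear form. -/
def IsSymmetric (K : Type u) (Λ : Type v) [Field K] [Ring Λ] [Algebra K Λ] : Prop :=
  ∃ φ : Λ →ₗ[K] K, (∀ a b, φ (a * b) = φ (b * a)) ∧ ∀ a, (∀ b, φ (a * b) = 0) → a = 0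

/-- A primitive idempotent: nonzero, and not a sum of two nonzero orthogonal idempotents. -/
def IsPrimitiveIdempotent {Λ : Type v} [Ring Λ] (e : Λ) : Prop :=
  IsIdempotentElem e ∧ e ≠ 0 ∧ ∀ f g : Λ, IsIdempotentElem f → IsIdempotentElem g →
    f * g = 0 → g * f = 0 → e = f + g → f = 0 ∨ g = 0

variable {Λ : Type v} [Ring Λ] {ι : Type w}

/-- The right module `P_i = e_i Λ`. -/
abbrev proj (e : ι → Λ) (i : ι) : Submodule Λᵐᵒᵖ Λ := Submodule.span Λᵐᵒᵖ {e i}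

/-- `e` is a complete set of primitive orthogonal idempotents of `Λ` such that the right modules
`e_i Λ` are pairwise non-isomorphic. A finite-dimensional algebra is basic if it has such a set;
the index set is then the set of vertices of its quiver. -/
structure IsBasicSystem [Fintype ι] (e : ι → Λ) : Prop where
  complete : CompleteOrthogonalIdempotents e
  primitive : ∀ i, IsPrimitiveIdempotent (e i)
  basic : ∀ i j, Nonempty (proj e i ≃ₗ[Λᵐᵒᵖ] proj e j) → i = j

variable (K : Type u) [Field K] [Algebra K Λ]

variable (Λ) in
/-- The Jacobson radical of `Λ`, as a `K`-subspace. -/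
def rad : Submodule K Λ := (Ring.jacobson Λ).restrictScalars K

/-- The `K`-space `e_i (rad Λ / rad² Λ) e_j`, as a subspace of `Λ / rad² Λ`. -/
def arrowSpace (e : ι → Λ) (i j : ι) : Submodule K (Λ ⧸ (rad Λ K) ^ 2) :=
  ((rad Λ K).map (LinearMap.mulLeftRight K (e i, e j))).map ((rad Λ K) ^ 2).mkQ

/-- The vertices of the (Gabriel) quiver of a basic algebra. -/
@[nolint unusedArguments]
def QuiverOf (_K : Type u) (_e : ι → Λ) : Type w := ι

/-- The (Gabriel) quiver of a basic algebra: the arrows `i ⟶ j` are indexed by a basis of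
`e_i (rad Λ / rad² Λ) e_j`. -/
instance (e : ι → Λ) : Quiver.{0} (QuiverOf K e) :=
  ⟨fun i j => Fin (Module.finrank K (arrowSpace K e i j))⟩

/-- The indecomposable projective right module at a vertex of the quiver. -/
abbrev P (e : ι → Λ) (i : QuiverOf K e) : Submodule Λᵐᵒᵖ Λ := proj e i

/-- `P_i⁺ = ⨁_{α : i ⟶ j} P_j`, the sum over all arrows starting at `i`. -/
abbrev PPlus (e : ι → Λ) (i : QuiverOf K e) : Type (max v w) :=
  ⨁ α : Quiver.Star i, P K e α.1

/-- `P_i⁻ = ⨁_{γ : k ⟶ i} P_k`, the sum over all arrows ending at `i`. -/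
abbrev PMinus (e : ι → Λ) (i : QuiverOf K e) : Type (max v w) :=
  ⨁ γ : Quiver.Costar i, P K e γ.1

end Algebras

section Quivers

/-- The quiver has exactly one vertex and exactly one arrow. -/
def IsLoopQuiver (Q : Type w) [Quiver.{0} Q] : Prop :=
  ∃ i : Q, (∀ k, k = i) ∧ Nonempty (Unique (i ⟶ i))

/-- The quiver has exactly two vertices `i ≠ j` and exactly two arrows `i ⟶ j` and `j ⟶ i`. -/
def IsTwoCycleQuiver (Q : Type w) [Quiver.{0} Q] : Prop :=
  ∃ i j : Q, i ≠ j ∧ (∀ k, k = i ∨ k = j) ∧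
    Nonempty (Unique (i ⟶ j)) ∧ Nonempty (Unique (j ⟶ i)) ∧ IsEmpty (i ⟶ i) ∧ IsEmpty (j ⟶ j)

end Quivers

section Conditions

variable {ι : Type w} {Λ : Type v} [Ring Λ]

variable (Λ) in
/-- There is a simple right `Λ`-module `S` such that `Ω²(S)` is simple. -/
def ConditionA : Prop :=
  ∃ (S : Type v) (_ : AddCommGroup S) (_ : Module Λᵐᵒᵖ S) (T : Type v) (_ : AddCommGroup T)
    (_ : Module Λᵐᵒᵖ T), IsSimpleModule Λᵐᵒᵖ S ∧ IsNthSyzygy Λᵐᵒᵖ 2 S T ∧ IsSimpleModule Λᵐᵒᵖ T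

/-- There is an arrow `α : i ⟶ j` that is the only arrow starting at `i` and the only arrow ending
at `j`. -/
def ConditionB (Q : Type w) [Quiver.{0} Q] : Prop :=
  ∃ (i j : Q) (α : i ⟶ j), (∀ β : Quiver.Star i, β = ⟨j, α⟩) ∧
    (∀ γ : Quiver.Costar j, γ = ⟨i, α⟩)

/-- There is a vertex `i` with `dim P_i = dim P_i⁺ = dim P_i⁻`. -/
def ConditionC (K : Type u) [Field K] [Algebra K Λ] (e : ι → Λ) : Prop :=
  ∃ i : QuiverOf K e, Module.finrank K (P K e i) = Module.finrank K (PPlus K e i) ∧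
    Module.finrank K (P K e i) = Module.finrank K (PMinus K e i)

end Conditions

end RepFinSym

end

noncomputable section

namespace RepFinSym

/-! ### The radical and the local structure at a primitive idempotent -/

section Local

/-! Everything passes through `Links K e i j a`: an element `a` of `e_i (rad Λ) e_j` generating `e_i
(rad Λ)` as a right module and `(rad Λ) e_j` as a left module. Each of (a), (b), (c) amounts to the
existence of a link.

For (b) this is Nakayama's lemma together with a count of arrows (`conditionB_iff_exists_links`).
For (a) and (c), let `S_i` be the top of `P_i`. Then `Ω(S_i) = e_i (rad Λ)`, and `Ω²(S_i)` is the
kernel of `P_i⁺ → e_i (rad Λ)`, which contains the socle of every summand. If this kernel is simple,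
or one-dimensional as rank-nullity gives under (c), there is a single arrow `a : i → j` and the
kernel is the socle of `P_j`; the symmetrizing form then shows that `a` also generates `(rad Λ) e_j`
(`IsArrowBasis.links_of_ker`). Conversely a link gives `Ω²(S_i) ≅ S_j`, because the top and the
socle of `P_j` agree.

Periodicity enters once: `Ω⁴(S_i) ≅ S_i` forces `Ω²(S_j) ≅ S_i`, so there is a link back from `j` to
`i` (`Links.exists_symm`). This yields (c). It also shows that no nonzero element of `Λ` connects
`i` or `j` to another vertex, so by connectedness these are all the vertices.

Every vertex is now the source and the target of a link, so on both sides the indecomposable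
projectives have principal radicals; this is `IsSerialSystem`. Cyclic modules `R w` with `e_l w = w`
are then uniserial. An indecomposable module contains such a submodule of maximal Loewy length, and
a suitable map to some `R e_k` splits it off (`IsSerialSystem.exists_injective`). So every
indecomposable embeds into a uniserial `R e_k`, which has finitely many submodules. -/

theorem isNilpotent_mul_swap {R : Type*} [Ring R] {a b : R} (h : IsNilpotent (a * b)) :
    IsNilpotent (b * a) := by
  obtain ⟨n, hn⟩ := h
  refine ⟨n + 1, ?_⟩
  have : ∀ m : ℕ, (b * a) ^ (m + 1) = b * (a * b) ^ m * a := by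
    intro m
    induction m with
    | zero => simp
    | succ m ih => rw [pow_succ, ih, pow_succ (a * b)]; simp only [mul_assoc]
  rw [this, hn, mul_zero, zero_mul]

theorem mem_jacobson_of_isNilpotent {R : Type*} [Ring R] {y : R}
    (h : ∀ r, IsNilpotent (r * y)) : y ∈ Ring.jacobson R := by
  rw [← Ideal.jacobson_bot, Ideal.mem_jacobson_iff]
  intro r
  obtain ⟨u, hu⟩ := (h r).isUnit_one_add
  refine ⟨↑u⁻¹, ?_⟩
  have h1 : (↑u⁻¹ : R) * (1 + r * y) = 1 := by rw [← hu]; simp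
  have h2 : (↑u⁻¹ : R) * r * y + ↑u⁻¹ - 1 = ↑u⁻¹ * (1 + r * y) - 1 := by noncomm_ring
  rw [h2, h1]
  simp

variable {K : Type u} [Field K] {Λ : Type v} [Ring Λ] [Algebra K Λ]

theorem mul_mem_rad_left (r : Λ) {x : Λ} (hx : x ∈ rad Λ K) : r * x ∈ rad Λ K :=
  (Ring.jacobson Λ).mul_mem_left r hx

theorem mul_mem_rad_right (r : Λ) {x : Λ} (hx : x ∈ rad Λ K) : x * r ∈ rad Λ K :=
  (Ring.jacobson Λ).mul_mem_right r hx

variable (K Λ) in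
theorem rad_pow_eq_bot [FiniteDimensional K Λ] : ∃ n, (rad Λ K) ^ n = ⊥ := by
  have : IsArtinianRing Λ := IsArtinianRing.of_finite K Λ
  obtain ⟨n, hn⟩ := IsArtinianRing.isNilpotent_jacobson_bot (R := Λ)
  rw [Ideal.jacobson_bot] at hn
  have key : ∀ m : ℕ, ∀ x ∈ (rad Λ K) ^ (m + 1), x ∈ (Ring.jacobson Λ) ^ (m + 1) := by
    intro m
    induction m with
    | zero => intro x hx; rw [zero_add, Submodule.pow_one] at hx ⊢; exact hx
    | succ m ih =>
      intro x hx
      rw [Submodule.pow_succ] at hx ⊢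
      refine Submodule.mul_induction_on hx (fun a ha b hb => ?_) (fun a b ha hb => add_mem ha hb)
      exact Ideal.mul_mem_mul (ih a ha) hb
  refine ⟨n + 1, (Submodule.eq_bot_iff _).2 fun x hx => ?_⟩
  have := key n x hx
  rw [Submodule.pow_succ, hn] at this
  simpa using this

theorem isNilpotent_of_mem_rad [FiniteDimensional K Λ] {x : Λ} (hx : x ∈ rad Λ K) :
    IsNilpotent x := by
  obtain ⟨n, hn⟩ := rad_pow_eq_bot K Λ
  refine ⟨n, ?_⟩
  have := Submodule.pow_mem_pow _ hx n
  rw [hn] at this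
  simpa using this

/-- Elements of the corner at a primitive idempotent are nilpotent or invertible. -/
theorem IsPrimitiveIdempotent.isNilpotent_or_exists_inverse [FiniteDimensional K Λ] {e : Λ}
    (he : IsPrimitiveIdempotent e) {x : Λ} (h1 : e * x = x) (h2 : x * e = x) :
    IsNilpotent x ∨ ∃ y, e * y = y ∧ y * e = y ∧ x * y = e ∧ y * x = e := by
  obtain ⟨p, hp0, hpx⟩ : ∃ p : Polynomial K, p ≠ 0 ∧ Polynomial.aeval x p = 0 :=
    ⟨minpoly K x, minpoly.ne_zero (Algebra.IsIntegral.isIntegral x), minpoly.aeval K x⟩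
  obtain ⟨q, hq, hXq⟩ := Polynomial.exists_eq_pow_rootMultiplicity_mul_and_not_dvd p hp0 0
  generalize Polynomial.rootMultiplicity 0 p = m at hq
  rw [Polynomial.C_0, sub_zero] at hq hXq
  -- With `p = X ^ m * q` and `q` prime to `X`, a Bézout relation splits `e` into two orthogonal
  -- idempotents. The exponent `m + 1` rather than `m` makes the first one a multiple of `x` even
  -- when `m = 0`.
  obtain ⟨a, b, hab⟩ : IsCoprime (Polynomial.X ^ (m + 1)) q :=
    (((Polynomial.irreducible_X).coprime_iff_not_dvd).2 hXq).pow_left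
  have hee : e * e = e := he.1
  have ecomm : ∀ r : Polynomial K, e * Polynomial.aeval x r = Polynomial.aeval x r * e := by
    intro r
    refine Algebra.adjoin_induction (p := fun y _ => e * y = y * e) ?_ ?_ ?_ ?_
      (Polynomial.aeval_mem_adjoin_singleton K x (p := r))
    · rintro y rfl; exact h1.trans h2.symm
    · intro c; exact (Algebra.commutes c e).symm
    · intro y z _ _ hy hz; rw [mul_add, add_mul, hy, hz]
    · intro y z _ _ hy hz; rw [← mul_assoc, hy, mul_assoc, hz, mul_assoc]
  obtain ⟨E, hE⟩ : ∃ E : Polynomial K → Λ, ∀ r, E r = e * Polynomial.aeval x r :=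
    ⟨_, fun _ => rfl⟩
  have Emul : ∀ r s, E r * E s = E (r * s) := fun r s => by
    rw [hE, hE, hE, map_mul, ecomm r, mul_assoc, ← mul_assoc e e, hee, ← mul_assoc, ← ecomm r,
      mul_assoc]
  have Eadd : ∀ r s, E r + E s = E (r + s) := fun r s => by rw [hE, hE, hE, map_add, mul_add]
  have E1 : E 1 = e := by simp [hE]
  have Epow : ∀ n : ℕ, E (Polynomial.X ^ (n + 1)) = x ^ (n + 1) := fun n => by
    rw [hE, map_pow, Polynomial.aeval_X, pow_succ', ← mul_assoc, h1]
  have EX : E Polynomial.X = x := by simpa using Epow 0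
  have Ep : ∀ r, E (r * p) = 0 := fun r => by rw [hE, map_mul, hpx, mul_zero, mul_zero]
  have key : a * Polynomial.X ^ (m + 1) * (b * q) = a * b * Polynomial.X * p := by
    rw [hq]; ring
  have hfg : E (a * Polynomial.X ^ (m + 1)) * E (b * q) = 0 := by rw [Emul, key, Ep]
  have hgf : E (b * q) * E (a * Polynomial.X ^ (m + 1)) = 0 := by rw [Emul, mul_comm, key, Ep]
  have hsum : e = E (a * Polynomial.X ^ (m + 1)) + E (b * q) := by rw [Eadd, hab, E1]
  have eE : ∀ r, e * E r = E r := fun r => by rw [hE, ← mul_assoc, hee]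
  have Ee : ∀ r, E r * e = E r := fun r => by rw [hE, ecomm, mul_assoc, hee]
  have hf : IsIdempotentElem (E (a * Polynomial.X ^ (m + 1))) := by
    have h := Ee (a * Polynomial.X ^ (m + 1))
    rwa [hsum, mul_add, hfg, add_zero] at h
  have hg : IsIdempotentElem (E (b * q)) := by
    have h := Ee (b * q)
    rwa [hsum, mul_add, hgf, zero_add] at h
  rcases he.2.2 _ _ hf hg hfg hgf hsum with h | h
  · left
    refine ⟨m + 1, ?_⟩
    rw [h, zero_add] at hsum
    rw [← Epow, ← Ee, hsum, Emul]
    have : Polynomial.X ^ (m + 1) * (b * q) = b * Polynomial.X * p := by rw [hq]; ring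
    rw [this, Ep]
  · right
    rw [h, add_zero] at hsum
    refine ⟨E (a * Polynomial.X ^ m), eE _, Ee _, ?_, ?_⟩
    · rw [← EX, Emul, hsum]; congr 1; ring
    · rw [← EX, Emul, hsum]; congr 1; ring

/-- Over an algebraically closed field, every element of the corner at a primitive idempotent is
the sum of a scalar and a nilpotent element. -/
theorem IsPrimitiveIdempotent.exists_isNilpotent_sub_smul [IsAlgClosed K] [FiniteDimensional K Λ]
    {e : Λ} (he : IsPrimitiveIdempotent e) {x : Λ} (h1 : e * x = x) (h2 : x * e = x) :
    ∃ c : K, IsNilpotent (x - c • e) := by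
  have hee : e * e = e := he.1
  -- Left multiplication by `x` on `eΛ` has an eigenvalue `c`; then `x - c • e` kills a nonzero
  -- vector of `eΛ`, so it is not invertible in the corner.
  let V : Submodule K Λ := LinearMap.range (LinearMap.mulLeft K e)
  have hV : ∀ v, v ∈ V ↔ e * v = v := fun v =>
    ⟨by rintro ⟨w, rfl⟩; simp [← mul_assoc, hee], fun h => ⟨v, h⟩⟩
  let f : Module.End K V := (LinearMap.mulLeft K x).restrict fun v _ =>
    (hV _).2 (by simp [← mul_assoc, h1])
  have : Nontrivial V :=
    ⟨⟨⟨e, (hV e).2 hee⟩, 0, fun h => he.2.1 (congrArg Subtype.val h)⟩⟩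
  obtain ⟨c, hc⟩ := Module.End.exists_eigenvalue f
  obtain ⟨v, hv⟩ := hc.exists_hasEigenvector
  have hxv : x * v = c • (v : Λ) := congrArg Subtype.val hv.apply_eq_smul
  refine ⟨c, (he.isNilpotent_or_exists_inverse (K := K) ?_ ?_).resolve_right ?_⟩
  · rw [mul_sub, h1, mul_smul_comm, hee]
  · rw [sub_mul, h2, smul_mul_assoc, hee]
  · rintro ⟨y, -, -, -, hy⟩
    apply hv.2
    apply Subtype.ext
    have hev := (hV v).1 v.2
    calc (v : Λ) = y * (x - c • e) * v := by rw [hy, hev]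
      _ = 0 := by rw [mul_assoc, sub_mul, hxv, smul_mul_assoc, hev, sub_self, mul_zero]

theorem eq_zero_of_isNilpotent_of_mul_eq {e y t : Λ} (ht : e * t = t)
    (hyt : y * t = e) (h : IsNilpotent y) : e = 0 := by
  obtain ⟨n, hn⟩ := h
  have : ∀ n : ℕ, y ^ n * e = 0 → e = 0 := by
    intro n
    induction n with
    | zero => simp
    | succ n ih =>
      intro h
      apply ih
      rw [← hyt, ← mul_assoc, ← pow_succ, ← ht, ← mul_assoc, h, zero_mul]
  exact this n (by rw [hn, zero_mul])

/-- For any `r`, the element `y * r * e` lies in the local corner at `e`. Were it invertible there,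
`y` would have a right inverse in the corner, which a nilpotent element cannot have. -/
theorem IsPrimitiveIdempotent.mem_rad_of_isNilpotent [FiniteDimensional K Λ]
    {e : Λ} (he : IsPrimitiveIdempotent e) {y : Λ} (h1 : e * y = y) (h2 : y * e = y)
    (h : IsNilpotent y) : y ∈ rad Λ K := by
  have hee : e * e = e := he.1
  refine mem_jacobson_of_isNilpotent fun r => isNilpotent_mul_swap ?_
  have : IsNilpotent (y * r * e) := by
    refine (he.isNilpotent_or_exists_inverse (K := K) (by simp only [← mul_assoc, h1])
      (by rw [mul_assoc, hee])).resolve_right ?_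
    rintro ⟨t, ht1, ht2, ht3, ht4⟩
    refine he.2.1 (eq_zero_of_isNilpotent_of_mul_eq (t := e * r * e * t)
      (by simp only [← mul_assoc, hee]) ?_ h)
    refine Eq.trans ?_ ht3
    simp only [← mul_assoc, h2]
  simpa only [← mul_assoc, h1] using isNilpotent_mul_swap this

theorem mem_proj_iff {ι : Type w} {e : ι → Λ} {i : ι} (he : IsIdempotentElem (e i)) {x : Λ} :
    x ∈ proj e i ↔ e i * x = x := by
  rw [proj, Submodule.mem_span_singleton]
  constructor
  · rintro ⟨r, rfl⟩
    simp only [MulOpposite.smul_eq_mul_unop]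
    rw [← mul_assoc, he]
  · intro h
    exact ⟨MulOpposite.op x, h⟩

end Local

/-! ### Basic algebras: modulo the radical only multiples of the `e i` survive -/

section Basic

variable (K : Type u) [Field K] {Λ : Type v} [Ring Λ] [Algebra K Λ]
  {ι : Type w} [Fintype ι] {e : ι → Λ}

namespace IsBasicSystem

theorem idem (h : IsBasicSystem e) (i : ι) : e i * e i = e i := h.complete.idem i

theorem mul_ne (h : IsBasicSystem e) {i j : ι} (hij : i ≠ j) : e i * e j = 0 :=
  h.complete.ortho hij

theorem mem_proj (h : IsBasicSystem e) {i : ι} {x : Λ} : x ∈ proj e i ↔ e i * x = x :=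
  mem_proj_iff (h.idem i)

theorem mul_mem_proj (h : IsBasicSystem e) (i : ι) (x : Λ) : e i * x ∈ proj e i :=
  h.mem_proj.2 (by rw [← mul_assoc, h.idem])

theorem sum_mul (h : IsBasicSystem e) (x : Λ) : ∑ i, e i * x = x := by
  rw [← Finset.sum_mul, h.complete.complete, one_mul]

theorem mul_sum (h : IsBasicSystem e) (x : Λ) : ∑ i, x * e i = x := by
  rw [← Finset.mul_sum, h.complete.complete, mul_one]

/-- If some `y * r * e k` were invertible in its corner, `y` would have a right inverse `t`. Then `t
* y` is an idempotent below the primitive `e j`, hence `0` or `e j`: the first gives `e k = 0`, the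
second an isomorphism `P_j ≅ P_k`. -/
theorem mem_rad_of_ne [FiniteDimensional K Λ] (h : IsBasicSystem e) {j k : ι} (hjk : j ≠ k)
    {y : Λ} (h1 : e k * y = y) (h2 : y * e j = y) : y ∈ rad Λ K := by
  refine mem_jacobson_of_isNilpotent fun r => isNilpotent_mul_swap ?_
  have : IsNilpotent (y * r * e k) := by
    refine ((h.primitive k).isNilpotent_or_exists_inverse (K := K)
      (by simp only [← mul_assoc, h1]) (by rw [mul_assoc, h.idem])).resolve_right ?_
    rintro ⟨s, hs1, hs2, hs3, hs4⟩
    obtain ⟨t, ht1, ht2, hyt⟩ : ∃ t, e j * t = t ∧ t * e k = t ∧ y * t = e k := by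
      refine ⟨e j * r * e k * s, by simp only [← mul_assoc, h.idem], by rw [mul_assoc, hs2], ?_⟩
      refine Eq.trans ?_ hs3
      simp only [← mul_assoc, h2]
    have htt : IsIdempotentElem (t * y) := by
      rw [IsIdempotentElem, mul_assoc, ← mul_assoc y, hyt, h1]
    have hej : e j * (t * y) = t * y := by rw [← mul_assoc, ht1]
    have hje : t * y * e j = t * y := by rw [mul_assoc, h2]
    rcases (h.primitive j).2.2 (t * y) (e j - t * y) htt
      (by rw [IsIdempotentElem, sub_mul, mul_sub, mul_sub, h.idem, hej, hje, htt]; abel)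
      (by rw [mul_sub, hje, htt, sub_self]) (by rw [sub_mul, hej, htt, sub_self])
      (by abel) with h0 | h0
    · apply (h.primitive k).2.1
      rw [← h.idem k]
      nth_rw 1 [← hyt]
      rw [← hyt, mul_assoc, ← mul_assoc t, h0, zero_mul, mul_zero]
    · rw [sub_eq_zero] at h0
      refine hjk (h.basic j k ⟨LinearEquiv.ofLinearMap
        ((LinearMap.mulLeft Λᵐᵒᵖ y).restrict fun x _ => h.mem_proj.2 ?_)
        ((LinearMap.mulLeft Λᵐᵒᵖ t).restrict fun x _ => h.mem_proj.2 ?_) ?_ ?_⟩)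
      · simp [← mul_assoc, h1]
      · simp [← mul_assoc, ht1]
      · ext x
        simp [← mul_assoc, hyt, h.mem_proj.1 x.2]
      · ext x
        simp [← mul_assoc, ← h0, h.mem_proj.1 x.2]
  simpa only [← mul_assoc, h1] using isNilpotent_mul_swap this

variable [IsAlgClosed K] [FiniteDimensional K Λ]

theorem exists_corner_sub_mem_rad (h : IsBasicSystem e) (i : ι) (x : Λ) :
    ∃ c : K, e i * x * e i - c • e i ∈ rad Λ K := by
  have h1 : e i * (e i * x * e i) = e i * x * e i := by simp only [← mul_assoc, h.idem]
  have h2 : e i * x * e i * e i = e i * x * e i := by simp only [mul_assoc, h.idem]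
  obtain ⟨c, hc⟩ := (h.primitive i).exists_isNilpotent_sub_smul (K := K) h1 h2
  refine ⟨c, (h.primitive i).mem_rad_of_isNilpotent ?_ ?_ hc⟩
  · rw [mul_sub, h1, mul_smul_comm, h.idem]
  · rw [sub_mul, h2, smul_mul_assoc, h.idem]

theorem exists_mul_left_sub_mem_rad (h : IsBasicSystem e) (i : ι) (x : Λ) :
    ∃ c : K, e i * x - c • e i ∈ rad Λ K := by
  classical
  obtain ⟨c, hc⟩ := h.exists_corner_sub_mem_rad K i x
  refine ⟨c, ?_⟩
  have : e i * x - c • e i = (e i * x * e i - c • e i) +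
      ∑ j ∈ Finset.univ.erase i, e i * x * e j := by
    nth_rw 1 [← h.mul_sum (e i * x)]
    rw [← Finset.add_sum_erase _ _ (Finset.mem_univ i)]
    abel
  rw [this]
  refine add_mem hc (sum_mem fun j hj => h.mem_rad_of_ne K (Finset.ne_of_mem_erase hj)
    (by simp only [← mul_assoc, h.idem]) (by rw [mul_assoc, h.idem]))

theorem exists_mul_right_sub_mem_rad (h : IsBasicSystem e) (i : ι) (x : Λ) :
    ∃ c : K, x * e i - c • e i ∈ rad Λ K := by
  classical
  obtain ⟨c, hc⟩ := h.exists_corner_sub_mem_rad K i x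
  refine ⟨c, ?_⟩
  have : x * e i - c • e i = (e i * x * e i - c • e i) +
      ∑ j ∈ Finset.univ.erase i, e j * (x * e i) := by
    nth_rw 1 [← h.sum_mul (x * e i)]
    rw [← Finset.add_sum_erase _ _ (Finset.mem_univ i), mul_assoc]
    abel
  rw [this]
  refine add_mem hc (sum_mem fun j hj => h.mem_rad_of_ne K (Finset.ne_of_mem_erase hj).symm
    (by simp only [← mul_assoc, h.idem]) (by simp only [mul_assoc, h.idem]))

end IsBasicSystem

end Basic

/-! ### Symmetric algebras -/

section Symmetric

variable {K : Type u} [Field K] {Λ : Type v} [Ring Λ] [Algebra K Λ]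

/-- The left and right socles coincide: cyclic invariance of `φ` moves the radical factor to the
other side of `z`. -/
theorem IsSymmetric.mul_rad_eq_zero_iff (hs : IsSymmetric K Λ) {z : Λ} :
    (∀ y ∈ rad Λ K, z * y = 0) ↔ ∀ y ∈ rad Λ K, y * z = 0 := by
  obtain ⟨φ, hφ, hn⟩ := hs
  constructor
  · intro h y hy
    refine hn _ fun b => ?_
    rw [mul_assoc, hφ, mul_assoc, h _ (mul_mem_rad_left b hy), map_zero]
  · intro h y hy
    refine hn _ fun b => ?_
    rw [mul_assoc, hφ, h _ (mul_mem_rad_right b hy), map_zero]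

theorem exists_dual_representation [FiniteDimensional K Λ] {φ : Λ →ₗ[K] K}
    (hφ : ∀ a b, φ (a * b) = φ (b * a)) (hn : ∀ a, (∀ b, φ (a * b) = 0) → a = 0)
    (g : Λ →ₗ[K] K) : ∃ y, ∀ x, g x = φ (x * y) := by
  let B : Λ →ₗ[K] Module.Dual K Λ := (LinearMap.mul K Λ).flip.compr₂ φ
  have hB : Function.Injective B := by
    rw [← LinearMap.ker_eq_bot, LinearMap.ker_eq_bot']
    intro y hy
    exact hn y fun b => by rw [hφ]; exact LinearMap.congr_fun hy b
  obtain ⟨y, hy⟩ := (LinearMap.injective_iff_surjective_of_finrank_eq_finrank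
    (Subspace.dual_finrank_eq (K := K) (V := Λ)).symm).1 hB g
  exact ⟨y, fun x => (LinearMap.congr_fun hy x).symm⟩

theorem exists_dual_separation {A : Submodule K Λ} [FiniteDimensional K Λ] {φ : Λ →ₗ[K] K}
    (hφ : ∀ a b, φ (a * b) = φ (b * a)) (hn : ∀ a, (∀ b, φ (a * b) = 0) → a = 0)
    {x : Λ} (hx : x ∉ A) : ∃ y, (∀ a ∈ A, φ (a * y) = 0) ∧ φ (x * y) ≠ 0 := by
  obtain ⟨g, hg, hgA⟩ := Submodule.exists_le_ker_of_notMem hx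
  obtain ⟨y, hy⟩ := exists_dual_representation hφ hn g
  exact ⟨y, fun a ha => by rw [← hy]; exact hgA ha, by rw [← hy]; exact hg⟩

variable {ι : Type w} {e : ι → Λ}

variable (K) in
/-- `z` spans the common left and right socle of `Λ` at the vertex `i`. -/
structure IsSocleGenerator (e : ι → Λ) (i : ι) (z : Λ) : Prop where
  ne_zero : z ≠ 0
  left : e i * z = z
  right : z * e i = z
  mul_rad : ∀ y ∈ rad Λ K, z * y = 0
  rad_mul : ∀ y ∈ rad Λ K, y * z = 0
  unique : ∀ x, e i * x = x → (∀ y ∈ rad Λ K, x * y = 0) → ∃ c : K, x = c • z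

theorem IsBasicSystem.exists_isSocleGenerator [Fintype ι] [IsAlgClosed K] [FiniteDimensional K Λ]
    (h : IsBasicSystem e) (hs : IsSymmetric K Λ) (i : ι) : ∃ z, IsSocleGenerator K e i z := by
  obtain ⟨φ, hφ, hn⟩ := id hs
  -- On socle elements at `i`, any `b * e i` acts as a scalar, so the single number `φ (x * e i)`
  -- determines `x`. This makes the socle one-dimensional.
  have crit : ∀ x, e i * x = x → (∀ y ∈ rad Λ K, x * y = 0) → φ (x * e i) = 0 → x = 0 := by
    intro x h1 h2 h3
    refine hn x fun b => ?_
    obtain ⟨c, hc⟩ := h.exists_mul_right_sub_mem_rad K i b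
    have : x * (b * e i) = c • (x * e i) := by
      have := h2 _ hc
      rwa [mul_sub, sub_eq_zero, mul_smul_comm] at this
    rw [← h1, mul_assoc, hφ, mul_assoc, this, map_smul, h3, smul_zero]
  obtain ⟨z, hz0, hz1, hz2⟩ : ∃ z, z ≠ 0 ∧ e i * z = z ∧ ∀ y ∈ rad Λ K, z * y = 0 := by
    classical
    -- A socle element is found in the last power of the radical not annihilated by `e i`.
    have hex : ∃ n, ∀ x ∈ (rad Λ K) ^ n, e i * x = 0 := by
      obtain ⟨n, hn⟩ := rad_pow_eq_bot K Λ
      exact ⟨n, fun x hx => by rw [hn, Submodule.mem_bot] at hx; rw [hx, mul_zero]⟩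
    obtain ⟨m, hm⟩ : ∃ m, Nat.find hex = m + 1 := by
      refine Nat.exists_eq_succ_of_ne_zero fun h0 => (h.primitive i).2.1 ?_
      have := Nat.find_spec hex
      rw [h0, pow_zero] at this
      simpa using this 1 (Submodule.one_le.1 le_rfl)
    have h1 := Nat.find_spec hex
    have h2 := Nat.find_min hex (m := m) (by omega)
    push Not at h2
    obtain ⟨x, hx, hx0⟩ := h2
    refine ⟨e i * x, hx0, by rw [← mul_assoc, h.idem], fun y hy => ?_⟩
    rw [mul_assoc]
    apply h1
    rw [hm, pow_succ]
    exact Submodule.mul_mem_mul hx hy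
  have hzφ : φ (z * e i) ≠ 0 := fun h0 => hz0 (crit z hz1 hz2 h0)
  have hz3 : ∀ y ∈ rad Λ K, z * e i * y = 0 := fun y hy => by
    rw [mul_assoc]; exact hz2 _ (mul_mem_rad_left _ hy)
  have hzi : z * e i * e i = z * e i := by rw [mul_assoc, h.idem]
  refine ⟨z * e i, fun h0 => hzφ (by rw [h0, map_zero]), by rw [← mul_assoc, hz1], hzi, hz3,
    hs.mul_rad_eq_zero_iff.1 hz3, fun x hx1 hx2 => ⟨φ (x * e i) / φ (z * e i), ?_⟩⟩
  rw [← sub_eq_zero]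
  apply crit
  · rw [mul_sub, hx1, mul_smul_comm, ← mul_assoc, hz1]
  · intro y hy
    rw [sub_mul, hx2 y hy, smul_mul_assoc, hz3 y hy, smul_zero, sub_zero]
  · rw [sub_mul, smul_mul_assoc, hzi, map_sub, map_smul, smul_eq_mul, div_mul_cancel₀ _ hzφ,
      sub_self]

theorem IsSocleGenerator.mul_eq_zero_iff [Fintype ι] [IsAlgClosed K] [FiniteDimensional K Λ]
    {i : ι} {z : Λ} (hz : IsSocleGenerator K e i z) (h : IsBasicSystem e)
    {x : Λ} (hx : e i * x = x) : z * x = 0 ↔ x ∈ rad Λ K := by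
  refine ⟨fun h0 => ?_, hz.mul_rad x⟩
  obtain ⟨c, hc⟩ := h.exists_mul_left_sub_mem_rad K i x
  have := hz.mul_rad _ hc
  rw [hx, mul_sub, h0, zero_sub, neg_eq_zero, mul_smul_comm, hz.right] at this
  rw [(smul_eq_zero.1 this).resolve_right hz.ne_zero, zero_smul, sub_zero, hx] at hc
  exact hc

variable (K) in
/-- `a` generates both the right module `e_i (rad Λ)` and the left module `(rad Λ) e_j`. -/
structure Links (e : ι → Λ) (i j : ι) (a : Λ) : Prop where
  ne_zero : a ≠ 0
  left : e i * a = a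
  right : a * e j = a
  mem : a ∈ rad Λ K
  gen : ∀ x ∈ rad Λ K, ∃ y, e i * x = a * y
  cogen : ∀ x ∈ rad Λ K, ∃ y, x * e j = y * a

theorem Links.rad_mul_eq_zero {i j : ι} {a : Λ} (ha : Links K e i j a) {x : Λ}
    (hx : e j * x = x) (hax : a * x = 0) : ∀ y ∈ rad Λ K, y * x = 0 := by
  intro y hy
  obtain ⟨r, hr⟩ := ha.cogen y hy
  rw [← hx, ← mul_assoc, hr, mul_assoc, hax, mul_zero]

/-- If the kernel of `a : e_j Λ → e_i (rad Λ)` lies in the socle then `a` generates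
`(rad Λ) e_j`. -/
theorem IsSymmetric.links_of_generates [Fintype ι] [FiniteDimensional K Λ] (hs : IsSymmetric K Λ)
    (h : IsBasicSystem e) {i j : ι} {a : Λ}
    (ne_zero : a ≠ 0) (left : e i * a = a) (right : a * e j = a) (mem : a ∈ rad Λ K)
    (gen : ∀ x ∈ rad Λ K, ∃ y, e i * x = a * y)
    (hker : ∀ x, e j * x = x → a * x = 0 → ∀ y ∈ rad Λ K, x * y = 0) : Links K e i j a := by
  refine ⟨ne_zero, left, right, mem, gen, fun x hx => ?_⟩
  obtain ⟨φ, hφ, hn⟩ := id hs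
  by_contra hcon
  have hxA : x * e j ∉ LinearMap.range (LinearMap.mulRight K a) := by
    rintro ⟨y, hy⟩
    exact hcon ⟨y, hy.symm⟩
  -- A functional vanishing on `Λ a` but not at `x * e j` is represented by some `y`. Then `a * y =
  -- 0`, so `e j * y` lies in the socle and is killed by `x` from the left, a contradiction.
  obtain ⟨y, hy, hxy⟩ := exists_dual_separation hφ hn hxA
  apply hxy
  have hay : a * (e j * y) = 0 := by
    rw [← mul_assoc, right]
    refine hn _ fun b => ?_
    rw [hφ, ← mul_assoc]
    exact hy _ ⟨b, rfl⟩
  rw [mul_assoc, hs.mul_rad_eq_zero_iff.1 (hker _ (by rw [← mul_assoc, h.idem]) hay) x hx,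
    map_zero]

end Symmetric

/-! ### Nakayama's lemma -/

section Nakayama

variable {K : Type u} [Field K] {Λ : Type v} [Ring Λ] [Algebra K Λ] [FiniteDimensional K Λ]

theorem le_of_le_sup_mul_rad {X Y : Submodule K Λ} (hX : X * rad Λ K ≤ X)
    (hY : Y ≤ X ⊔ Y * rad Λ K) : Y ≤ X := by
  obtain ⟨n, hn⟩ := rad_pow_eq_bot K Λ
  have : ∀ n : ℕ, Y ≤ X ⊔ Y * (rad Λ K) ^ n := by
    intro n
    induction n with
    | zero => simp
    | succ n ih =>
      refine hY.trans (sup_le le_sup_left ?_)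
      calc Y * rad Λ K ≤ (X ⊔ Y * (rad Λ K) ^ n) * rad Λ K := mul_le_mul' ih le_rfl
        _ = X * rad Λ K ⊔ Y * (rad Λ K) ^ (n + 1) := by rw [Submodule.sup_mul, mul_assoc, pow_succ]
        _ ≤ _ := sup_le_sup_right hX _
  simpa [hn] using this n

theorem le_of_le_sup_rad_mul {X Y : Submodule K Λ} (hX : rad Λ K * X ≤ X)
    (hY : Y ≤ X ⊔ rad Λ K * Y) : Y ≤ X := by
  obtain ⟨n, hn⟩ := rad_pow_eq_bot K Λ
  have : ∀ n : ℕ, Y ≤ X ⊔ (rad Λ K) ^ n * Y := by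
    intro n
    induction n with
    | zero => simp
    | succ n ih =>
      refine hY.trans (sup_le le_sup_left ?_)
      calc rad Λ K * Y ≤ rad Λ K * (X ⊔ (rad Λ K) ^ n * Y) := mul_le_mul' le_rfl ih
        _ = rad Λ K * X ⊔ (rad Λ K) ^ (n + 1) * Y := by
          rw [Submodule.mul_sup, ← mul_assoc, pow_succ']
        _ ≤ _ := sup_le_sup_right hX _
  simpa [hn] using this n

end Nakayama

/-! ### Syzygies -/

section Syzygies

variable {R : Type w} [Ring R] {M M' N N' L P Q : Type v}
  [AddCommGroup M] [Module R M] [AddCommGroup M'] [Module R M'] [AddCommGroup N] [Module R N]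
  [AddCommGroup N'] [Module R N'] [AddCommGroup L] [Module R L] [AddCommGroup P] [Module R P]
  [AddCommGroup Q] [Module R Q]

theorem IsProjectiveCover.congr {f : P →ₗ[R] M} (hf : IsProjectiveCover f) (σ : M ≃ₗ[R] M') :
    IsProjectiveCover (σ.toLinearMap ∘ₗ f) := by
  refine ⟨hf.1, σ.surjective.comp hf.2.1, ?_⟩
  rw [LinearEquiv.ker_comp]
  exact hf.2.2

/-- Projective covers are unique up to isomorphism. -/
theorem IsProjectiveCover.exists_equiv {f : P →ₗ[R] M} (hf : IsProjectiveCover f)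
    {g : Q →ₗ[R] M} (hg : IsProjectiveCover g) : ∃ h : P ≃ₗ[R] Q, g ∘ₗ h.toLinearMap = f := by
  obtain ⟨hP, hfs, hfk⟩ := hf
  obtain ⟨hQ, hgs, hgk⟩ := hg
  obtain ⟨h, hh⟩ := Module.projective_lifting_property g f hgs
  have hsurj : Function.Surjective h := by
    rw [← LinearMap.range_eq_top]
    apply hgk
    rw [eq_top_iff]
    intro q _
    obtain ⟨p, hp⟩ := hfs (g q)
    rw [Submodule.mem_sup]
    refine ⟨q - h p, ?_, h p, ⟨p, rfl⟩, sub_add_cancel _ _⟩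
    rw [LinearMap.mem_ker, map_sub, ← hp, ← hh, LinearMap.comp_apply, sub_self]
  -- A section of the lift has range complementing the superfluous `ker f`, so it is onto, and the
  -- lift is injective.
  obtain ⟨s, hs⟩ := Module.projective_lifting_property h LinearMap.id hsurj
  have hs' : ∀ q, h (s q) = q := fun q => LinearMap.congr_fun hs q
  have hst : LinearMap.range s = ⊤ := by
    apply hfk
    rw [eq_top_iff]
    intro p _
    rw [Submodule.mem_sup]
    refine ⟨p - s (h p), ?_, s (h p), ⟨_, rfl⟩, sub_add_cancel _ _⟩
    rw [LinearMap.mem_ker, ← hh, LinearMap.comp_apply, map_sub, hs', sub_self, map_zero]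
  have hinj : Function.Injective h := by
    intro p p' hpp
    obtain ⟨q, rfl⟩ := LinearMap.range_eq_top.1 hst p
    obtain ⟨q', rfl⟩ := LinearMap.range_eq_top.1 hst p'
    rw [hs', hs'] at hpp
    rw [hpp]
  exact ⟨LinearEquiv.ofBijective h ⟨hinj, hsurj⟩, hh⟩

theorem IsProjectiveCover.ker_equiv {f : P →ₗ[R] M} (hf : IsProjectiveCover f)
    {g : Q →ₗ[R] M} (hg : IsProjectiveCover g) :
    Nonempty (LinearMap.ker f ≃ₗ[R] LinearMap.ker g) := by
  obtain ⟨h, hh⟩ := hf.exists_equiv hg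
  refine ⟨h.ofSubmodules _ _ ?_⟩
  rw [← hh, LinearMap.ker_comp, Submodule.map_comap_eq_of_surjective h.surjective]

theorem IsSyzygy.congr (h : IsSyzygy R M N) (σ : M ≃ₗ[R] M') (τ : N ≃ₗ[R] N') :
    IsSyzygy R M' N' := by
  obtain ⟨P, _, _, f, hf, ⟨ρ⟩⟩ := h
  refine ⟨P, _, _, _, hf.congr σ, ⟨τ.symm ≪≫ₗ ρ ≪≫ₗ LinearEquiv.ofEq _ _ ?_⟩⟩
  rw [LinearEquiv.ker_comp]

theorem IsSyzygy.unique (h : IsSyzygy R M N) (h' : IsSyzygy R M N') : Nonempty (N ≃ₗ[R] N') := by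
  obtain ⟨P, _, _, f, hf, ⟨ρ⟩⟩ := h
  obtain ⟨P', _, _, f', hf', ⟨ρ'⟩⟩ := h'
  obtain ⟨κ⟩ := hf.ker_equiv hf'
  exact ⟨ρ ≪≫ₗ κ ≪≫ₗ ρ'.symm⟩

theorem IsNthSyzygy.congr {n : ℕ} (h : IsNthSyzygy R n M N) (σ : M ≃ₗ[R] M') (τ : N ≃ₗ[R] N') :
    IsNthSyzygy R n M' N' := by
  induction n generalizing M M' with
  | zero => obtain ⟨ρ⟩ := h; exact ⟨τ.symm ≪≫ₗ ρ ≪≫ₗ σ⟩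
  | succ n ih =>
    obtain ⟨L, _, _, h1, h2⟩ := h
    exact ⟨L, _, _, h1.congr σ (LinearEquiv.refl R L), ih h2 (LinearEquiv.refl R L)⟩

theorem IsNthSyzygy.unique {n : ℕ} (h : IsNthSyzygy R n M N) (h' : IsNthSyzygy R n M N') :
    Nonempty (N ≃ₗ[R] N') := by
  induction n generalizing M with
  | zero => obtain ⟨ρ⟩ := h; obtain ⟨ρ'⟩ := h'; exact ⟨ρ ≪≫ₗ ρ'.symm⟩
  | succ n ih =>
    obtain ⟨L, _, _, h1, h2⟩ := h
    obtain ⟨L', _, _, h1', h2'⟩ := h'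
    obtain ⟨κ⟩ := h1.unique h1'
    exact ih (h2.congr κ (LinearEquiv.refl R N)) h2'

theorem IsNthSyzygy.trans {m n : ℕ} (h : IsNthSyzygy R m M L) (h' : IsNthSyzygy R n L N) :
    IsNthSyzygy R (m + n) M N := by
  induction m generalizing M with
  | zero =>
    obtain ⟨ρ⟩ := h
    rw [zero_add]
    exact h'.congr ρ (LinearEquiv.refl R N)
  | succ m ih =>
    obtain ⟨L', _, _, h1, h2⟩ := h
    rw [Nat.succ_add]
    exact ⟨L', _, _, h1, ih h2⟩

/-- The remaining syzygy after splitting off an initial part of the resolution. -/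
theorem IsNthSyzygy.of_add {m n : ℕ} (h : IsNthSyzygy R m M L)
    (h' : IsNthSyzygy R (m + n) M N) : IsNthSyzygy R n L N := by
  induction m generalizing M with
  | zero =>
    obtain ⟨ρ⟩ := h
    rw [zero_add] at h'
    exact h'.congr ρ.symm (LinearEquiv.refl R N)
  | succ m ih =>
    obtain ⟨L₁, _, _, h1, h2⟩ := h
    rw [Nat.succ_add] at h'
    obtain ⟨L₂, _, _, h3, h4⟩ := h'
    obtain ⟨κ⟩ := h3.unique h1
    exact ih h2 (h4.congr κ (LinearEquiv.refl R N))

theorem IsNthSyzygy.mul {n : ℕ} (h : IsNthSyzygy R n M M) (k : ℕ) :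
    IsNthSyzygy R (n * k) M M := by
  induction k with
  | zero => exact ⟨LinearEquiv.refl R M⟩
  | succ k ih => exact ih.trans h

theorem IsSyzygy.subsingleton_of_projective [Module.Projective R M] (h : IsSyzygy R M N) :
    Subsingleton N := by
  have : IsProjectiveCover (LinearMap.id : M →ₗ[R] M) := by
    refine ⟨inferInstance, Function.surjective_id, fun B hB => ?_⟩
    rwa [LinearMap.ker_id, bot_sup_eq] at hB
  obtain ⟨P, _, _, f, hf, ⟨ρ⟩⟩ := h
  obtain ⟨κ⟩ := hf.ker_equiv this
  rw [LinearMap.ker_id] at κ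
  exact (ρ ≪≫ₗ κ).toEquiv.subsingleton

end Syzygies

/-! ### Projective covers of simple modules and of their syzygies -/

section Superfluous

variable {R : Type*} [Ring R] {M : Type*} [AddCommGroup M] [Module R M]

/-- This is Nakayama's lemma for arbitrary modules: nilpotence of the Jacobson radical replaces
finite generation. -/
theorem isSuperfluous_of_le_jacobson_smul_top [IsArtinianRing R] {A : Submodule R M}
    (hA : A ≤ Ring.jacobson R • (⊤ : Submodule R M)) : IsSuperfluous A := by
  intro B hB
  obtain ⟨n, hn⟩ := IsArtinianRing.isNilpotent_jacobson_bot (R := R)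
  rw [Ideal.jacobson_bot] at hn
  have key : ∀ n : ℕ, B ⊔ Ring.jacobson R ^ (n + 1) • (⊤ : Submodule R M) = ⊤ := by
    have h1 : B ⊔ Ring.jacobson R • (⊤ : Submodule R M) = ⊤ :=
      top_unique (hB.symm.le.trans (sup_le (hA.trans le_sup_right) le_sup_left))
    intro n
    induction n with
    | zero => rw [zero_add, Submodule.pow_one, h1]
    | succ n ih =>
      refine top_unique (ih.symm.le.trans (sup_le le_sup_left ?_))
      rw [Submodule.pow_succ (n := n + 1), ← smul_eq_mul, Submodule.smul_assoc]
      nth_rw 1 [← h1]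
      rw [Submodule.smul_sup]
      exact sup_le_sup_right Submodule.smul_le_right _
  have := key n
  rw [Submodule.pow_succ, hn] at this
  simpa using this

end Superfluous

section Op

variable {Λ : Type v} [Ring Λ]

variable (Λ) in
/-- The regular right module is free of rank one. -/
def opSelfEquiv : Λᵐᵒᵖ ≃ₗ[Λᵐᵒᵖ] Λ where
  toFun x := x.unop
  invFun x := MulOpposite.op x
  map_add' _ _ := rfl
  map_smul' _ _ := rfl

instance : Module.Projective Λᵐᵒᵖ Λ := Module.Projective.of_equiv (opSelfEquiv Λ)

variable {K : Type u} [Field K] [Algebra K Λ] [FiniteDimensional K Λ]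

theorem op_mem_jacobson {x : Λ} (hx : x ∈ rad Λ K) :
    MulOpposite.op x ∈ Ring.jacobson Λᵐᵒᵖ := by
  refine mem_jacobson_of_isNilpotent fun r => ?_
  obtain ⟨n, hn⟩ := isNilpotent_of_mem_rad (mul_mem_rad_right r.unop hx)
  exact ⟨n, MulOpposite.unop_injective (by simpa using hn)⟩

end Op

section Cover

variable {K : Type u} [Field K] {Λ : Type v} [Ring Λ] [Algebra K Λ] {ι : Type w} {e : ι → Λ}

theorem IsBasicSystem.projective_proj [Fintype ι] (h : IsBasicSystem e) (i : ι) :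
    Module.Projective Λᵐᵒᵖ (proj e i) := by
  refine Module.Projective.of_split (proj e i).subtype
    ((LinearMap.mulLeft Λᵐᵒᵖ (e i)).codRestrict _ fun x => h.mul_mem_proj i x) ?_
  ext x
  exact h.mem_proj.1 x.2

variable (K) in
/-- The radical `e_i (rad Λ)` of `e_i Λ`. -/
def radProj (e : ι → Λ) (i : ι) : Submodule Λᵐᵒᵖ Λ where
  carrier := {x | e i * x = x ∧ x ∈ rad Λ K}
  add_mem' hx hy := ⟨by rw [mul_add, hx.1, hy.1], add_mem hx.2 hy.2⟩
  zero_mem' := ⟨mul_zero _, zero_mem _⟩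
  smul_mem' r x hx := ⟨by
    rw [MulOpposite.smul_eq_mul_unop, ← mul_assoc, hx.1], mul_mem_rad_right _ hx.2⟩

/-- The kernel of the projection from `e_i Λ` onto its top is `e_i (rad Λ)`. -/
def radProjEquivKer [Fintype ι] (h : IsBasicSystem e) {i : ι}
    {S : Type*} [AddCommGroup S] [Module Λᵐᵒᵖ S] (f : proj e i →ₗ[Λᵐᵒᵖ] S)
    (hker : ∀ x, f x = 0 ↔ (x : Λ) ∈ rad Λ K) : radProj K e i ≃ₗ[Λᵐᵒᵖ] LinearMap.ker f :=
  LinearEquiv.ofLinearMap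
    (((radProj K e i).subtype.codRestrict (proj e i) fun x => h.mem_proj.2 x.2.1).codRestrict _
      fun x => (hker _).2 x.2.2)
    (((proj e i).subtype ∘ₗ (LinearMap.ker f).subtype).codRestrict _
      fun x => ⟨h.mem_proj.1 x.1.2, (hker _).1 x.2⟩)
    (by ext; rfl) (by ext; rfl)

/-- The radical of `e_i Λ` is the syzygy of every module of which `e_i Λ → S` is the quotient by
the radical. -/
theorem IsBasicSystem.isSyzygy_radProj [Fintype ι] [FiniteDimensional K Λ] (h : IsBasicSystem e)
    {i : ι} {S : Type v} [AddCommGroup S] [Module Λᵐᵒᵖ S] (f : proj e i →ₗ[Λᵐᵒᵖ] S)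
    (hf : Function.Surjective f) (hker : ∀ x, f x = 0 ↔ (x : Λ) ∈ rad Λ K) :
    IsSyzygy Λᵐᵒᵖ S (radProj K e i) := by
  have : IsArtinianRing Λᵐᵒᵖ := IsArtinianRing.of_finite K Λᵐᵒᵖ
  refine ⟨proj e i, _, _, f, ⟨h.projective_proj i, hf,
    isSuperfluous_of_le_jacobson_smul_top fun x hx => ?_⟩, ⟨radProjEquivKer h f hker⟩⟩
  have hx' : x = MulOpposite.op (x : Λ) • (⟨e i, h.mem_proj.2 (h.idem i)⟩ : proj e i) :=
    Subtype.ext (h.mem_proj.1 x.2).symm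
  rw [hx']
  exact Submodule.smul_mem_smul (op_mem_jacobson ((hker x).1 hx)) Submodule.mem_top

variable (K) in
/-- The family `a` of elements of `e_i (rad Λ)` is a basis of `e_i (rad Λ / rad² Λ)` adapted to
the idempotents. -/
structure IsArrowBasis (e : ι → Λ) (i : ι) {A : Type*} [Fintype A] (t : A → ι) (a : A → Λ) :
    Prop where
  left : ∀ α, e i * a α = a α
  right : ∀ α, a α * e (t α) = a α
  mem : ∀ α, a α ∈ rad Λ K
  gen : ∀ x ∈ rad Λ K, ∃ y : A → Λ, e i * x = ∑ α, a α * y α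
  indep : ∀ c : A → K, ∑ α, c α • a α ∈ (rad Λ K) ^ 2 → c = 0

/-- The homomorphism `⨁ P_{t α} → Λ` given by left multiplication with the `a α`. -/
def arrowMap {A : Type*} [Fintype A] (e : ι → Λ) (t : A → ι) (a : A → Λ) :
    (∀ α, proj e (t α)) →ₗ[Λᵐᵒᵖ] Λ :=
  ∑ α, LinearMap.mulLeft Λᵐᵒᵖ (a α) ∘ₗ (proj e (t α)).subtype ∘ₗ LinearMap.proj α

theorem arrowMap_apply {A : Type*} [Fintype A] (t : A → ι) (a : A → Λ)
    (x : ∀ α, proj e (t α)) : arrowMap e t a x = ∑ α, a α * (x α : Λ) := by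
  simp [arrowMap]

theorem arrowMap_single {A : Type*} [Fintype A] [DecidableEq A] (t : A → ι) (a : A → Λ) (α : A)
    (x : proj e (t α)) : arrowMap e t a (Pi.single α x) = a α * x := by
  rw [arrowMap_apply, Finset.sum_eq_single α (fun β _ hβ => by simp [hβ]) (by simp),
    Pi.single_eq_same]

namespace IsArrowBasis

variable {A : Type*} [Fintype A] {t : A → ι} {a : A → Λ} {i : ι}

theorem ne_zero (ha : IsArrowBasis K e i t a) (α : A) : a α ≠ 0 := by
  classical
  intro h0
  have := ha.indep (Pi.single α 1) (by
    rw [Finset.sum_eq_single α (fun β _ hβ => by simp [hβ]) (by simp), h0, smul_zero]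
    exact zero_mem _)
  simpa using congrFun this α

theorem reindex (ha : IsArrowBasis K e i t a) {B : Type*} [Fintype B] (σ : B ≃ A) :
    IsArrowBasis K e i (t ∘ σ) (a ∘ σ) where
  left β := ha.left _
  right β := ha.right _
  mem β := ha.mem _
  gen x hx := by
    obtain ⟨y, hy⟩ := ha.gen x hx
    refine ⟨y ∘ σ, hy.trans ?_⟩
    exact (Equiv.sum_comp σ fun α => a α * y α).symm
  indep c hc := by
    have := ha.indep (c ∘ σ.symm) (by
      rw [← Equiv.sum_comp σ]
      simpa using hc)
    funext β
    simpa using congrFun this (σ β)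

theorem mem_range_arrowMap [Fintype ι] (ha : IsArrowBasis K e i t a) (h : IsBasicSystem e) {x : Λ} :
    x ∈ LinearMap.range (arrowMap e t a) ↔ x ∈ radProj K e i := by
  classical
  constructor
  · rintro ⟨y, rfl⟩
    rw [arrowMap_apply]
    refine sum_mem fun α _ => ⟨by rw [← mul_assoc, ha.left], mul_mem_rad_right _ (ha.mem α)⟩
  · rintro ⟨h1, h2⟩
    obtain ⟨y, hy⟩ := ha.gen x h2
    refine ⟨∑ α, Pi.single α
      ⟨e (t α) * y α, h.mul_mem_proj _ _⟩, ?_⟩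
    rw [map_sum, ← h1, hy]
    refine Finset.sum_congr rfl fun α _ => ?_
    rw [arrowMap_single, ← mul_assoc, ha.right]

variable [Fintype ι] [IsAlgClosed K] [FiniteDimensional K Λ]

/-- This makes the cover by `P_i⁺` minimal: modulo the radical each `x α` is a scalar `c α`, a
relation puts `∑ c α • a α` into `rad²`, and independence of the arrows gives `c = 0`. -/
theorem mem_rad_of_arrowMap_eq_zero (ha : IsArrowBasis K e i t a) (h : IsBasicSystem e)
    {x : ∀ α, proj e (t α)} (hx : arrowMap e t a x = 0) (α : A) : (x α : Λ) ∈ rad Λ K := by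
  choose c hc using fun α => h.exists_mul_left_sub_mem_rad K (t α) (x α : Λ)
  have hx' : ∀ α, e (t α) * (x α : Λ) = x α := fun α => h.mem_proj.1 (x α).2
  simp only [hx'] at hc
  rw [arrowMap_apply] at hx
  have hc0 : c = 0 := by
    apply ha.indep
    have : ∑ α, c α • a α = -∑ α, a α * (x α - c α • e (t α)) := by
      simp only [mul_sub, Finset.sum_sub_distrib, hx, mul_smul_comm, ha.right]
      simp
    rw [this, pow_two]
    exact neg_mem (sum_mem fun α _ => Submodule.mul_mem_mul (ha.mem α) (hc α))
  simpa [hc0] using hc α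

/-- The kernel of `P_i⁺ → e_i (rad Λ)` is a syzygy. -/
theorem isSyzygy_ker {N : ℕ} {t : Fin N → ι} {a : Fin N → Λ} (ha : IsArrowBasis K e i t a)
    (h : IsBasicSystem e) :
    IsSyzygy Λᵐᵒᵖ (radProj K e i) (LinearMap.ker (arrowMap e t a)) := by
  have : IsArtinianRing Λᵐᵒᵖ := IsArtinianRing.of_finite K Λᵐᵒᵖ
  have := fun α => h.projective_proj (t α)
  refine ⟨∀ α, proj e (t α), _, _, (arrowMap e t a).codRestrict _
    fun x => (ha.mem_range_arrowMap h).1 ⟨x, rfl⟩,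
    ⟨.of_equiv (DirectSum.linearEquivFunOnFintype Λᵐᵒᵖ (Fin N) fun α => proj e (t α)),
      fun x => ?_, ?_⟩,
    ⟨LinearEquiv.ofEq _ _ (LinearMap.ker_codRestrict _ _ _).symm⟩⟩
  · obtain ⟨y, hy⟩ := (ha.mem_range_arrowMap h).2 x.2
    exact ⟨y, Subtype.ext hy⟩
  · rw [LinearMap.ker_codRestrict]
    refine isSuperfluous_of_le_jacobson_smul_top fun x hx => ?_
    rw [← Finset.univ_sum_single x]
    refine sum_mem fun α _ => ?_
    have hx' : x α = MulOpposite.op (x α : Λ) •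
        (⟨e (t α), h.mem_proj.2 (h.idem _)⟩ : proj e (t α)) :=
      Subtype.ext (h.mem_proj.1 (x α).2).symm
    have : Pi.single α (x α) = MulOpposite.op (x α : Λ) •
        (Pi.single α ⟨e (t α), h.mem_proj.2 (h.idem _)⟩ : ∀ α, proj e (t α)) := by
      rw [← Pi.single_smul, ← hx']
    rw [this]
    exact Submodule.smul_mem_smul (op_mem_jacobson (ha.mem_rad_of_arrowMap_eq_zero h hx α))
      Submodule.mem_top

/-- If the second syzygy of the simple module at `i` is zero or simple and there is an arrow
starting at `i`, then this arrow is unique and links `i` to its target. -/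
theorem links_of_ker (ha : IsArrowBasis K e i t a) (h : IsBasicSystem e)
    (hs : IsSymmetric K Λ) [Nonempty A]
    (hker : ∀ x y, arrowMap e t a x = 0 → arrowMap e t a y = 0 → x ≠ 0 →
      ∃ r : Λᵐᵒᵖ, y = r • x) :
    ∃ α, (∀ β, β = α) ∧ Links K e i (t α) (a α) := by
  classical
  choose z hz using h.exists_isSocleGenerator hs
  -- The socle of each summand lies in the kernel. Socles of different summands are not multiples of
  -- one another, so there is only one summand.
  let s : ∀ α : A, ∀ β, proj e (t β) := fun α =>
    Pi.single α ⟨z (t α), h.mem_proj.2 (hz (t α)).left⟩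
  have hs0 : ∀ α, arrowMap e t a (s α) = 0 := fun α => by
    rw [arrowMap_single]
    exact (hz _).rad_mul _ (ha.mem α)
  have hsα : ∀ α, ((s α) α : Λ) = z (t α) := fun α => by
    simp only [s, Pi.single_eq_same]
  have hsne : ∀ α, s α ≠ 0 := fun α h0 => (hz (t α)).ne_zero (by rw [← hsα, h0]; rfl)
  have hsub : ∀ α β : A, β = α := by
    intro α β
    by_contra hne
    obtain ⟨r, hr⟩ := hker _ _ (hs0 α) (hs0 β) (hsne α)
    apply (hz (t β)).ne_zero
    have h0 : (s α) β = 0 := by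
      simp only [s, Pi.single_eq_of_ne hne]
    rw [← hsα, hr, Pi.smul_apply, h0, smul_zero]
    rfl
  obtain ⟨α⟩ := ‹Nonempty A›
  have : Unique A := ⟨⟨α⟩, hsub α⟩
  refine ⟨α, hsub α, hs.links_of_generates h (ha.ne_zero α) (ha.left α) (ha.right α) (ha.mem α)
    (fun x hx => ?_) fun x hx hax y hy => ?_⟩
  · obtain ⟨y, hy⟩ := ha.gen x hx
    refine ⟨y α, ?_⟩
    rw [hy, Fintype.sum_unique, hsub α default]
  · obtain ⟨r, hr⟩ := hker (s α)
      (Pi.single α ⟨x, h.mem_proj.2 hx⟩) (hs0 α)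
      (by rw [arrowMap_single, hax]) (hsne α)
    have := congrArg (fun w => ((w α : proj e (t α)) : Λ)) hr
    simp only [Pi.single_eq_same, Pi.smul_apply, Submodule.coe_smul, hsα,
      MulOpposite.smul_eq_mul_unop] at this
    rw [this, mul_assoc, (hz _).mul_rad _ (mul_mem_rad_left _ hy)]

end IsArrowBasis

end Cover

/-! ### Arrows of the Gabriel quiver -/

section Arrows

variable {K : Type u} [Field K] {Λ : Type v} [Ring Λ] [Algebra K Λ] {ι : Type w} {e : ι → Λ}

instance [Fintype ι] : Fintype (QuiverOf K e) := inferInstanceAs (Fintype ι)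

instance (i j : QuiverOf K e) : Fintype (i ⟶ j) := inferInstanceAs (Fintype (Fin _))

theorem mul_mem_rad_sq_right (r : Λ) {x : Λ} (hx : x ∈ (rad Λ K) ^ 2) : x * r ∈ (rad Λ K) ^ 2 := by
  rw [pow_two] at hx ⊢
  refine Submodule.mul_induction_on hx (fun x hx y hy => ?_) fun x y hx hy => ?_
  · rw [mul_assoc]
    exact Submodule.mul_mem_mul hx (mul_mem_rad_right _ hy)
  · rw [add_mul]
    exact add_mem hx hy

theorem mul_mul_mem_arrowSpace (i j : ι) {x : Λ} (hx : x ∈ rad Λ K) :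
    ((rad Λ K) ^ 2).mkQ (e i * x * e j) ∈ arrowSpace K e i j :=
  ⟨e i * x * e j, ⟨x, hx, rfl⟩, rfl⟩

theorem exists_of_mem_arrowSpace {i j : ι} {v : Λ ⧸ (rad Λ K) ^ 2} (hv : v ∈ arrowSpace K e i j) :
    ∃ x ∈ rad Λ K, ((rad Λ K) ^ 2).mkQ (e i * x * e j) = v := by
  obtain ⟨_, ⟨x, hx, rfl⟩, rfl⟩ := hv
  exact ⟨x, hx, rfl⟩

theorem finrank_arrowSpace_eq_zero_iff [FiniteDimensional K Λ] {i j : ι} :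
    Module.finrank K (arrowSpace K e i j) = 0 ↔
      ∀ x ∈ rad Λ K, e i * x * e j ∈ (rad Λ K) ^ 2 := by
  rw [Submodule.finrank_eq_zero, Submodule.eq_bot_iff]
  constructor
  · intro h x hx
    simpa using h _ (mul_mul_mem_arrowSpace i j hx)
  · intro h v hv
    obtain ⟨x, hx, rfl⟩ := exists_of_mem_arrowSpace hv
    simpa using h x hx

/-- The `a α` lift bases of the arrow spaces. They generate by Nakayama's lemma, and right
multiplication by `e j` isolates the arrows with target `j`, reducing independence to one arrow
space. -/
theorem IsBasicSystem.exists_isArrowBasis_sigma [Fintype ι] [FiniteDimensional K Λ]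
    (h : IsBasicSystem e) (i : ι) :
    ∃ a : (Σ j, Fin (Module.finrank K (arrowSpace K e i j))) → Λ,
      IsArrowBasis K e i (fun s => s.1) a := by
  classical
  let b := fun j => Module.finBasis K (arrowSpace K e i j)
  choose r hr hrb using fun j s => exists_of_mem_arrowSpace (b j s).2
  let a : (Σ j, Fin (Module.finrank K (arrowSpace K e i j))) → Λ := fun s => e i * r s.1 s.2 * e s.1
  have right : ∀ α, a α * e α.1 = a α := fun α => by simp only [a, mul_assoc, h.idem]
  have mem : ∀ α, a α ∈ rad Λ K := fun α => mul_mem_rad_right _ (mul_mem_rad_left _ (hr _ _))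
  refine ⟨a, fun α => by simp only [a, ← mul_assoc, h.idem], right, mem, ?_, ?_⟩
  · let X : Submodule K Λ :=
      LinearMap.range (∑ α, LinearMap.mulLeft K (a α) ∘ₗ LinearMap.proj (R := K) α)
    have hX : ∀ x, x ∈ X ↔ ∃ y : (Σ j, Fin (Module.finrank K (arrowSpace K e i j))) → Λ,
        x = ∑ α, a α * y α := by
      intro x
      simp [X, eq_comm]
    have key : (K ∙ e i) * rad Λ K ≤ X := by
      refine le_of_le_sup_mul_rad (Submodule.mul_le.2 fun x hx y _ => ?_) fun x hx => ?_
      · obtain ⟨u, rfl⟩ := (hX x).1 hx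
        exact (hX _).2 ⟨fun α => u α * y, by simp only [Finset.sum_mul, mul_assoc]⟩
      · obtain ⟨y, hy, rfl⟩ := Submodule.mem_span_singleton_mul.1 hx
        rw [← h.mul_sum (e i * y)]
        refine sum_mem fun j _ => ?_
        have hv := (b j).sum_repr ⟨_, mul_mul_mem_arrowSpace i j hy⟩
        set c := (b j).repr ⟨_, mul_mul_mem_arrowSpace i j hy⟩
        have hd : e i * y * e j - ∑ s, c s • a ⟨j, s⟩ ∈ (rad Λ K) ^ 2 := by
          refine (Submodule.Quotient.mk_eq_zero _).1 ?_
          have hv' := congrArg Subtype.val hv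
          rw [AddSubmonoidClass.coe_finsetSum] at hv'
          rw [← Submodule.mkQ_apply, map_sub, sub_eq_zero, map_sum]
          refine hv'.symm.trans ?_
          exact Finset.sum_congr rfl fun s _ => by rw [map_smul, hrb]; rfl
        have hd' : e i * (e i * y * e j - ∑ s, c s • a ⟨j, s⟩) =
            e i * y * e j - ∑ s, c s • a ⟨j, s⟩ := by
          rw [mul_sub, Finset.mul_sum]
          simp only [a, mul_smul_comm, ← mul_assoc, h.idem]
        rw [← add_sub_cancel (∑ s, c s • a ⟨j, s⟩) (e i * y * e j)]
        refine Submodule.add_mem_sup (sum_mem fun s _ => X.smul_mem _ ((hX _).2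
          ⟨Pi.single ⟨j, s⟩ 1, ?_⟩)) ?_
        · rw [Finset.sum_eq_single ⟨j, s⟩ (fun β _ hβ => by simp [hβ]) (by simp),
            Pi.single_eq_same, mul_one]
        · rw [mul_assoc, ← hd', ← pow_two]
          exact Submodule.mul_mem_mul (Submodule.mem_span_singleton_self _) hd
    intro x hx
    exact (hX _).1 (key (Submodule.mul_mem_mul (Submodule.mem_span_singleton_self _) hx))
  · intro c hc
    funext ⟨j, s⟩
    have h1 : ∑ s, c ⟨j, s⟩ • a ⟨j, s⟩ ∈ (rad Λ K) ^ 2 := by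
      have h2 : (∑ α, c α • a α) * e j = ∑ s, c ⟨j, s⟩ • a ⟨j, s⟩ := by
        rw [Finset.sum_mul, Fintype.sum_sigma, Finset.sum_eq_single j]
        · exact Finset.sum_congr rfl fun s _ => by rw [smul_mul_assoc, right ⟨j, s⟩]
        · intro k _ hk
          refine Finset.sum_eq_zero fun s _ => ?_
          rw [smul_mul_assoc, ← right ⟨k, s⟩, mul_assoc, h.mul_ne hk, mul_zero, smul_zero]
        · simp
      rw [← h2]
      exact mul_mem_rad_sq_right _ hc
    have h3 : ∑ s, c ⟨j, s⟩ • b j s = 0 := by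
      apply Subtype.ext
      have h4 := (Submodule.Quotient.mk_eq_zero _).2 h1
      rw [← Submodule.mkQ_apply, map_sum] at h4
      rw [AddSubmonoidClass.coe_finsetSum]
      refine Eq.trans (Finset.sum_congr rfl fun s _ => ?_) h4
      rw [map_smul, hrb]
      rfl
    exact Fintype.linearIndependent_iff.1 (b j).linearIndependent _ h3 s

theorem IsBasicSystem.exists_isArrowBasis [Fintype ι] [FiniteDimensional K Λ]
    (h : IsBasicSystem e) (i : QuiverOf K e) :
    ∃ a : Quiver.Star i → Λ, IsArrowBasis K e i (fun s => s.1) a :=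
  h.exists_isArrowBasis_sigma i

/-- Indexing by `Fin N` keeps the product of the `P_j` in the universe of `Λ`, as `IsSyzygy`
requires; `Quiver.Star i` lives in the universe of `ι`. -/
theorem IsBasicSystem.exists_isArrowBasis_fin [Fintype ι] [FiniteDimensional K Λ]
    (h : IsBasicSystem e) (i : ι) :
    ∃ (N : ℕ) (t : Fin N → ι) (a : Fin N → Λ), IsArrowBasis K e i t a := by
  obtain ⟨a, ha⟩ := h.exists_isArrowBasis_sigma (K := K) i
  exact ⟨_, _, _, ha.reindex (Fintype.equivFin _).symm⟩

theorem isEmpty_hom_of_finrank {i j : QuiverOf K e}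
    (hij : Module.finrank K (arrowSpace K e i j) = 0) : IsEmpty (i ⟶ j) := by
  change IsEmpty (Fin (Module.finrank K (arrowSpace K e i j)))
  rw [hij]
  infer_instance

theorem nonempty_unique_hom_of_finrank {i j : QuiverOf K e}
    (hij : Module.finrank K (arrowSpace K e i j) = 1) : Nonempty (Unique (i ⟶ j)) := by
  change Nonempty (Unique (Fin (Module.finrank K (arrowSpace K e i j))))
  rw [hij]
  exact ⟨inferInstance⟩

end Arrows

/-! ### Links and unique arrows -/

section LinksArrows

variable {K : Type u} [Field K] {Λ : Type v} [Ring Λ] [Algebra K Λ] [FiniteDimensional K Λ]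
  {ι : Type w} {e : ι → Λ} {i j : ι} {a : Λ}

/-- Otherwise `e_i (rad Λ) = a Λ` would be contained in `e_i (rad Λ)²`, hence vanish by Nakayama's
lemma. -/
theorem Links.not_mem_rad_sq (ha : Links K e i j a) : a ∉ (rad Λ K) ^ 2 := by
  intro hmem
  have key : (K ∙ e i) * rad Λ K ≤ ⊥ := by
    refine le_of_le_sup_mul_rad (by simp) fun x hx => ?_
    obtain ⟨y, hy, rfl⟩ := Submodule.mem_span_singleton_mul.1 hx
    obtain ⟨r, hr⟩ := ha.gen y hy
    refine Submodule.mem_sup_right ?_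
    rw [hr, ← ha.left, mul_assoc, mul_assoc]
    refine Submodule.mul_mem_mul (Submodule.mem_span_singleton_self _) ?_
    rw [← pow_two]
    exact mul_mem_rad_sq_right _ hmem
  apply ha.ne_zero
  rw [← ha.left, ← Submodule.mem_bot (R := K)]
  exact key (Submodule.mul_mem_mul (Submodule.mem_span_singleton_self _) ha.mem)

variable [Fintype ι]

theorem Links.finrank_arrowSpace_left (ha : Links K e i j a) (h : IsBasicSystem e) {k : ι}
    (hk : k ≠ j) : Module.finrank K (arrowSpace K e i k) = 0 := by
  rw [finrank_arrowSpace_eq_zero_iff]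
  intro x hx
  obtain ⟨y, hy⟩ := ha.gen x hx
  have : e i * x * e k = a * (e j * y * e k) := by
    rw [hy]
    simp only [← mul_assoc, ha.right]
  rw [this, pow_two]
  exact Submodule.mul_mem_mul ha.mem (h.mem_rad_of_ne K hk (by simp only [← mul_assoc, h.idem])
    (by simp only [mul_assoc, h.idem]))

theorem Links.finrank_arrowSpace_right (ha : Links K e i j a) (h : IsBasicSystem e) {k : ι}
    (hk : k ≠ i) : Module.finrank K (arrowSpace K e k j) = 0 := by
  rw [finrank_arrowSpace_eq_zero_iff]
  intro x hx
  obtain ⟨y, hy⟩ := ha.cogen x hx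
  have : e k * x * e j = e k * y * e i * a := by
    rw [mul_assoc, hy]
    simp only [mul_assoc, ha.left]
  rw [this, pow_two]
  exact Submodule.mul_mem_mul (h.mem_rad_of_ne K hk.symm (by simp only [← mul_assoc, h.idem])
    (by simp only [mul_assoc, h.idem])) ha.mem

theorem Links.finrank_arrowSpace [IsAlgClosed K] (ha : Links K e i j a) (h : IsBasicSystem e) :
    Module.finrank K (arrowSpace K e i j) = 1 := by
  refine finrank_eq_one_iff'.2 ⟨⟨((rad Λ K) ^ 2).mkQ a, ?_⟩, ?_, fun ⟨v, hv⟩ => ?_⟩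
  · have := mul_mul_mem_arrowSpace (K := K) (e := e) i j ha.mem
    rwa [ha.left, ha.right] at this
  · intro h0
    have := congrArg Subtype.val h0
    exact ha.not_mem_rad_sq (by simpa using this)
  · obtain ⟨x, hx, rfl⟩ := exists_of_mem_arrowSpace hv
    obtain ⟨y, hy⟩ := ha.gen x hx
    obtain ⟨c, hc⟩ := h.exists_corner_sub_mem_rad K j y
    refine ⟨c, Subtype.ext ?_⟩
    simp only [Submodule.coe_smul, ← map_smul]
    rw [eq_comm, ← sub_eq_zero, ← map_sub, ← LinearMap.mem_ker, Submodule.ker_mkQ]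
    have : e i * x * e j - c • a = a * (e j * y * e j - c • e j) := by
      rw [hy, mul_sub, mul_smul_comm, ha.right]
      simp only [← mul_assoc, ha.right]
    rw [this, pow_two]
    exact Submodule.mul_mem_mul ha.mem hc

theorem Links.nonempty_unique_hom [IsAlgClosed K] {i j : QuiverOf K e}
    (ha : Links K e i j a) (h : IsBasicSystem e) :
    Nonempty (Unique (i ⟶ j)) :=
  nonempty_unique_hom_of_finrank (ha.finrank_arrowSpace h)

theorem Links.exists_unique_star [IsAlgClosed K] {i j : QuiverOf K e}
    (ha : Links K e i j a) (h : IsBasicSystem e) :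
    ∃ α : i ⟶ j,
      (∀ β : Quiver.Star i, β = ⟨j, α⟩) ∧
      ∀ γ : Quiver.Costar j, γ = ⟨i, α⟩ := by
  obtain ⟨hu⟩ := ha.nonempty_unique_hom h
  refine ⟨default, fun ⟨k, β⟩ => ?_, fun ⟨k, γ⟩ => ?_⟩
  · by_cases hk : k = j
    · subst hk
      rw [hu.uniq β]
    · exact ((isEmpty_hom_of_finrank (ha.finrank_arrowSpace_left h hk)).false β).elim
  · by_cases hk : k = i
    · subst hk
      rw [hu.uniq γ]
    · exact ((isEmpty_hom_of_finrank (ha.finrank_arrowSpace_right h hk)).false γ).elim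

/-- If `a` generates `e_i (rad Λ)` and there are no arrows ending at `j` from other vertices, then
`a` generates `(rad Λ) e_j`. -/
theorem IsBasicSystem.links_of_finrank_eq_zero [IsAlgClosed K] (h : IsBasicSystem e)
    (ne_zero : a ≠ 0) (left : e i * a = a) (right : a * e j = a) (mem : a ∈ rad Λ K)
    (gen : ∀ x ∈ rad Λ K, ∃ y, e i * x = a * y)
    (h0 : ∀ k, k ≠ i → Module.finrank K (arrowSpace K e k j) = 0) : Links K e i j a := by
  refine ⟨ne_zero, left, right, mem, gen, ?_⟩
  let X : Submodule K Λ := LinearMap.range (LinearMap.mulRight K a)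
  -- Nakayama's lemma on the left, one component `e k * x * e j` at a time: for `k = i` it is a
  -- scalar multiple of `a` modulo `rad² e_j`, and for `k ≠ i` it lies in `rad²`.
  have key : rad Λ K * (K ∙ e j) ≤ X := by
    refine le_of_le_sup_rad_mul (Submodule.mul_le.2 ?_) (Submodule.mul_le.2 ?_)
    · rintro r - _ ⟨y, rfl⟩
      exact ⟨r * y, by simp [mul_assoc]⟩
    · intro x hx y hy
      obtain ⟨c, rfl⟩ := Submodule.mem_span_singleton.1 hy
      rw [mul_smul_comm]
      refine Submodule.smul_mem _ _ ?_
      rw [← h.sum_mul (x * e j)]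
      refine sum_mem fun k _ => ?_
      by_cases hk : k = i
      · subst hk
        obtain ⟨y, hy⟩ := gen x hx
        obtain ⟨c, hc⟩ := h.exists_corner_sub_mem_rad K j y
        have : e k * x * e j = c • a + a * ((e j * y * e j - c • e j) * e j) := by
          rw [hy, sub_mul, mul_sub, smul_mul_assoc, h.idem, mul_smul_comm, right]
          simp only [← mul_assoc, right]
          rw [mul_assoc _ (e j), h.idem]
          abel
        rw [← mul_assoc (e k), this]
        exact Submodule.add_mem_sup (X.smul_mem _ ⟨1, by simp⟩)
          (Submodule.mul_mem_mul mem (Submodule.mul_mem_mul hc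
            (Submodule.mem_span_singleton_self _)))
      · have hmem := finrank_arrowSpace_eq_zero_iff.1 (h0 k hk) x hx
        refine Submodule.mem_sup_right ?_
        have : e k * x * e j = e k * x * e j * e j := by rw [mul_assoc _ (e j), h.idem]
        rw [← mul_assoc (e k), this, ← mul_assoc (rad Λ K), ← pow_two]
        exact Submodule.mul_mem_mul hmem (Submodule.mem_span_singleton_self _)
  intro x hx
  obtain ⟨y, hy⟩ := key (Submodule.mul_mem_mul hx (Submodule.mem_span_singleton_self _))
  exact ⟨y, hy.symm⟩

theorem IsBasicSystem.exists_links [IsAlgClosed K] (h : IsBasicSystem e) {i j : QuiverOf K e}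
    {α : i ⟶ j} (hα : ∀ β : Quiver.Star i, β = ⟨j, α⟩)
    (hγ : ∀ γ : Quiver.Costar j, γ = ⟨i, α⟩) : ∃ a, Links K e i j a := by
  obtain ⟨b, hb⟩ := h.exists_isArrowBasis (K := K) i
  have : Unique (Quiver.Star i) := ⟨⟨⟨j, α⟩⟩, hα⟩
  refine ⟨b ⟨j, α⟩, h.links_of_finrank_eq_zero (hb.ne_zero _) (hb.left _) (hb.right ⟨j, α⟩)
    (hb.mem _) (fun x hx => ?_) fun k hk => ?_⟩
  · obtain ⟨y, hy⟩ := hb.gen x hx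
    exact ⟨y ⟨j, α⟩, by rw [hy, Fintype.sum_unique, hα default]⟩
  · by_contra hne
    have hγ' := hγ ⟨k, (⟨0, Nat.pos_of_ne_zero hne⟩ :
      Fin (Module.finrank K (arrowSpace K e k j)))⟩
    exact hk (congrArg Sigma.fst hγ')

theorem conditionB_iff_exists_links [IsAlgClosed K] (h : IsBasicSystem e) :
    ConditionB (QuiverOf K e) ↔ ∃ (i j : ι) (a : Λ), Links K e i j a := by
  constructor
  · rintro ⟨i, j, α, h1, h2⟩
    exact ⟨i, j, h.exists_links h1 h2⟩
  · rintro ⟨i, j, a, ha⟩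
    exact ⟨i, j, ha.exists_unique_star h⟩

end LinksArrows

/-! ### Simple modules and their second syzygies -/

section Simple

variable {K : Type u} [Field K] {Λ : Type v} [Ring Λ] [Algebra K Λ] {ι : Type w} {e : ι → Λ}

variable (K) in
/-- The socle of `e_i Λ`. -/
def socProj (e : ι → Λ) (i : ι) : Submodule Λᵐᵒᵖ Λ where
  carrier := {x | e i * x = x ∧ ∀ y ∈ rad Λ K, x * y = 0}
  add_mem' hx hy := ⟨by rw [mul_add, hx.1, hy.1],
    fun y hyr => by rw [add_mul, hx.2 y hyr, hy.2 y hyr, add_zero]⟩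
  zero_mem' := ⟨mul_zero _, fun _ _ => zero_mul _⟩
  smul_mem' r x hx := ⟨by rw [MulOpposite.smul_eq_mul_unop, ← mul_assoc, hx.1],
    fun y hy => by rw [MulOpposite.smul_eq_mul_unop, mul_assoc, hx.2 _ (mul_mem_rad_left _ hy)]⟩

theorem IsSocleGenerator.mem_socProj {i : ι} {z : Λ} (hz : IsSocleGenerator K e i z) :
    z ∈ socProj K e i := ⟨hz.left, hz.mul_rad⟩

theorem algebraMap_op_smul (c : K) (x : Λ) : algebraMap K Λᵐᵒᵖ c • x = c • x :=
  algebraMap_smul _ _ _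

theorem IsSocleGenerator.exists_smul_eq {i : ι} {z : Λ} (hz : IsSocleGenerator K e i z) {x : Λ}
    (hx : x ∈ socProj K e i) : ∃ c : K, x = algebraMap K Λᵐᵒᵖ c • z := by
  obtain ⟨c, hc⟩ := hz.unique x hx.1 hx.2
  exact ⟨c, by rw [algebraMap_op_smul, hc]⟩

/-- The socle of `e_i Λ` serves as the model of the simple module at `i`; being one-dimensional, it
is generated by any nonzero element under scalars alone. -/
theorem IsSocleGenerator.isSimpleModule {i : ι} {z : Λ} (hz : IsSocleGenerator K e i z) :
    IsSimpleModule Λᵐᵒᵖ (socProj K e i) := by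
  rw [isSimpleModule_iff_toSpanSingleton_surjective]
  refine ⟨⟨⟨⟨z, hz.mem_socProj⟩, 0, fun h0 => hz.ne_zero (congrArg Subtype.val h0)⟩⟩, ?_⟩
  rintro ⟨x, hx⟩ hx0 ⟨y, hy⟩
  obtain ⟨c, rfl⟩ := hz.exists_smul_eq hx
  obtain ⟨d, rfl⟩ := hz.exists_smul_eq hy
  have hc : c ≠ 0 := by
    rintro rfl
    exact hx0 (Subtype.ext (by simp))
  refine ⟨algebraMap K Λᵐᵒᵖ (d * c⁻¹), Subtype.ext ?_⟩
  simp only [LinearMap.toSpanSingleton_apply, Submodule.coe_smul, smul_smul, ← map_mul]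
  rw [mul_assoc, inv_mul_cancel₀ hc, mul_one]

theorem IsSocleGenerator.finrank_socProj [FiniteDimensional K Λ] {i : ι} {z : Λ}
    (hz : IsSocleGenerator K e i z) : Module.finrank K (socProj K e i) = 1 := by
  refine finrank_eq_one_iff'.2 ⟨⟨z, hz.mem_socProj⟩,
    fun h0 => hz.ne_zero (congrArg Subtype.val h0), fun ⟨x, hx⟩ => ?_⟩
  obtain ⟨c, hc⟩ := hz.unique x hx.1 hx.2
  exact ⟨c, Subtype.ext hc.symm⟩

theorem Links.isArrowBasis [FiniteDimensional K Λ] {i j : ι} {a : Λ} (ha : Links K e i j a) :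
    IsArrowBasis K e i (fun _ : Fin 1 => j) (fun _ => a) where
  left _ := ha.left
  right _ := ha.right
  mem _ := ha.mem
  gen x hx := by
    obtain ⟨y, hy⟩ := ha.gen x hx
    exact ⟨fun _ => y, by simpa using hy⟩
  indep c hc := by
    funext k
    rw [Subsingleton.elim k 0]
    by_contra hne
    apply ha.not_mem_rad_sq
    simpa [smul_smul, inv_mul_cancel₀ hne] using ((rad Λ K) ^ 2).smul_mem (c 0)⁻¹ hc

/-- The projection of `e_i Λ` onto its socle. -/
def projToSocle {i : ι} {z : Λ} (hz : IsSocleGenerator K e i z) :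
    proj e i →ₗ[Λᵐᵒᵖ] socProj K e i :=
  (LinearMap.mulLeft Λᵐᵒᵖ z).restrict fun x _ =>
    (socProj K e i).smul_mem (MulOpposite.op x) hz.mem_socProj

variable [Fintype ι]

/-- The kernel of `e_j Λ → e_i (rad Λ)` is the socle of `e_j Λ`. -/
theorem Links.ker_equiv (h : IsBasicSystem e) (hs : IsSymmetric K Λ) {i j : ι} {a : Λ}
    (ha : Links K e i j a) :
    Nonempty (socProj K e j ≃ₗ[Λᵐᵒᵖ]
      LinearMap.ker (arrowMap e (fun _ : Fin 1 => j) (fun _ => a))) := by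
  refine ⟨LinearEquiv.ofLinearMap
    ((LinearMap.pi fun _ => (socProj K e j).subtype.codRestrict (proj e j)
      fun x => h.mem_proj.2 x.2.1).codRestrict _ fun x => ?_)
    (((proj e j).subtype ∘ₗ LinearMap.proj 0 ∘ₗ Submodule.subtype _).codRestrict _ fun x => ?_)
    ?_ ?_⟩
  · rw [LinearMap.mem_ker, arrowMap_apply, Fin.sum_univ_one]
    exact hs.mul_rad_eq_zero_iff.1 x.2.2 a ha.mem
  · have hx := x.2
    rw [LinearMap.mem_ker, arrowMap_apply, Fin.sum_univ_one] at hx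
    have hx' := h.mem_proj.1 (x.1 0).2
    exact ⟨hx', hs.mul_rad_eq_zero_iff.2 (ha.rad_mul_eq_zero hx' hx)⟩
  · ext x k
    rw [Subsingleton.elim k 0]
    rfl
  · ext x
    rfl

theorem projToSocle_surjective (h : IsBasicSystem e) {i : ι} {z : Λ}
    (hz : IsSocleGenerator K e i z) : Function.Surjective (projToSocle hz) := by
  rintro ⟨x, hx⟩
  obtain ⟨c, rfl⟩ := hz.exists_smul_eq hx
  refine ⟨algebraMap K Λᵐᵒᵖ c • ⟨e i, h.mem_proj.2 (h.idem i)⟩, ?_⟩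
  rw [map_smul]
  apply Subtype.ext
  change algebraMap K Λᵐᵒᵖ c • (z * e i) = _
  rw [hz.right]

variable [IsAlgClosed K] [FiniteDimensional K Λ]

theorem projToSocle_eq_zero_iff (h : IsBasicSystem e) {i : ι} {z : Λ}
    (hz : IsSocleGenerator K e i z) (x : proj e i) :
    projToSocle hz x = 0 ↔ (x : Λ) ∈ rad Λ K := by
  rw [← hz.mul_eq_zero_iff h (h.mem_proj.1 x.2), Subtype.ext_iff]
  rfl

/-- Right multiplication by `e i` is the identity on the socle at `i` and zero on the socle at any
other vertex. -/
theorem IsBasicSystem.eq_of_socProj_equiv (h : IsBasicSystem e) (hs : IsSymmetric K Λ) {i j : ι}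
    (σ : socProj K e i ≃ₗ[Λᵐᵒᵖ] socProj K e j) : i = j := by
  obtain ⟨z, hz⟩ := h.exists_isSocleGenerator hs i
  obtain ⟨z', hz'⟩ := h.exists_isSocleGenerator hs j
  by_contra hne
  let y : socProj K e i := ⟨z, hz.mem_socProj⟩
  have hy : y = MulOpposite.op (e i) • y := Subtype.ext hz.right.symm
  have h0 : σ y = 0 := by
    rw [hy, map_smul]
    apply Subtype.ext
    obtain ⟨c, hc⟩ := hz'.unique _ (σ y).2.1 (σ y).2.2
    change (σ y : Λ) * e i = 0
    rw [hc, smul_mul_assoc, ← hz'.right, mul_assoc, h.mul_ne (Ne.symm hne), mul_zero, smul_zero]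
  exact hz.ne_zero (congrArg Subtype.val ((LinearEquiv.map_eq_zero_iff σ).1 h0))

/-- Every simple right module is the quotient of some `e_i Λ` by its radical. -/
theorem IsBasicSystem.exists_proj_to_simple (h : IsBasicSystem e)
    (S : Type v) [AddCommGroup S] [Module Λᵐᵒᵖ S] [IsSimpleModule Λᵐᵒᵖ S] :
    ∃ (i : ι) (f : proj e i →ₗ[Λᵐᵒᵖ] S), Function.Surjective f ∧
      ∀ x, f x = 0 ↔ (x : Λ) ∈ rad Λ K := by
  have := IsSimpleModule.nontrivial Λᵐᵒᵖ S
  obtain ⟨s, hs⟩ := exists_ne (0 : S)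
  obtain ⟨i, hi⟩ : ∃ i, MulOpposite.op (e i) • s ≠ 0 := by
    by_contra! hcon
    apply hs
    rw [← one_smul Λᵐᵒᵖ s, ← MulOpposite.op_one, ← h.complete.complete,
      Finset.op_sum, Finset.sum_smul]
    exact Finset.sum_eq_zero fun i _ => hcon i
  let f : proj e i →ₗ[Λᵐᵒᵖ] S := LinearMap.toSpanSingleton Λᵐᵒᵖ S s ∘ₗ
    (opSelfEquiv Λ).symm.toLinearMap ∘ₗ (proj e i).subtype
  have hf : ∀ x, f x = MulOpposite.op (x : Λ) • s := fun x => rfl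
  let p : proj e i := ⟨e i, h.mem_proj.2 (h.idem i)⟩
  have hrad : ∀ x : proj e i, (x : Λ) ∈ rad Λ K → f x = 0 := by
    intro x hx
    have h1 := Ring.jacobson_smul_top_le (R := Λᵐᵒᵖ) (M := S)
      (Submodule.smul_mem_smul (op_mem_jacobson hx) (Submodule.mem_top (x := s)))
    rw [IsSemisimpleModule.jacobson_eq_bot] at h1
    exact h1
  refine ⟨i, f, ?_, fun x => ⟨fun hx => ?_, hrad x⟩⟩
  · rcases eq_bot_or_eq_top (LinearMap.range f) with h0 | h0
    · rw [LinearMap.range_eq_bot] at h0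
      exact (hi (by rw [← hf p, h0]; rfl)).elim
    · exact LinearMap.range_eq_top.1 h0
  -- Modulo the radical, which acts as zero on `S`, `x` is `c • e i`; since `f` does not kill `e i`,
  -- the scalar `c` vanishes.
  · obtain ⟨c, hc⟩ := h.exists_mul_left_sub_mem_rad K i (x : Λ)
    rw [h.mem_proj.1 x.2] at hc
    have h1 : f (algebraMap K Λᵐᵒᵖ c • p) = 0 := by
      have := hrad (x - algebraMap K Λᵐᵒᵖ c • p) (by
        rw [Submodule.coe_sub, Submodule.coe_smul, algebraMap_op_smul]
        exact hc)
      rwa [map_sub, hx, zero_sub, neg_eq_zero] at this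
    have hc0 : c = 0 := by
      by_contra hne
      apply hi
      rw [← hf p, ← one_smul Λᵐᵒᵖ p, ← map_one (algebraMap K Λᵐᵒᵖ), ← inv_mul_cancel₀ hne, map_mul,
        mul_smul, map_smul, h1, smul_zero]
    rwa [hc0, zero_smul, sub_zero] at hc

/-- If `i` is linked to `j` then `Ω²(S_i) ≅ S_j`. -/
theorem Links.isNthSyzygy (h : IsBasicSystem e) (hs : IsSymmetric K Λ) {i j : ι} {a : Λ}
    (ha : Links K e i j a) : IsNthSyzygy Λᵐᵒᵖ 2 (socProj K e i) (socProj K e j) := by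
  obtain ⟨z, hz⟩ := h.exists_isSocleGenerator hs i
  obtain ⟨κ⟩ := ha.ker_equiv h hs
  exact ⟨_, _, _, h.isSyzygy_radProj _ (projToSocle_surjective h hz)
    (projToSocle_eq_zero_iff h hz), _, _, _, ha.isArrowBasis.isSyzygy_ker h, ⟨κ⟩⟩

/-- By uniqueness of syzygies `T` is the kernel of `P_i⁺ → e_i (rad Λ)`, so `links_of_ker` applies.
There is an arrow at `i` because that kernel is nonzero. -/
theorem IsBasicSystem.exists_links_of_isNthSyzygy (h : IsBasicSystem e) (hs : IsSymmetric K Λ)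
    {i : ι} {S T : Type v} [AddCommGroup S] [Module Λᵐᵒᵖ S] [AddCommGroup T] [Module Λᵐᵒᵖ T]
    {f : proj e i →ₗ[Λᵐᵒᵖ] S} (hf : Function.Surjective f)
    (hker : ∀ x, f x = 0 ↔ (x : Λ) ∈ rad Λ K) (hST : IsNthSyzygy Λᵐᵒᵖ 2 S T)
    [IsSimpleModule Λᵐᵒᵖ T] : ∃ j a, Links K e i j a := by
  obtain ⟨N, t, b, hb⟩ := h.exists_isArrowBasis_fin (K := K) i
  obtain ⟨σ⟩ := IsNthSyzygy.unique (n := 1)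
    (IsNthSyzygy.of_add (m := 1) ⟨_, _, _, h.isSyzygy_radProj f hf hker, ⟨LinearEquiv.refl _ _⟩⟩
      hST)
    ⟨_, _, _, hb.isSyzygy_ker h, ⟨LinearEquiv.refl _ _⟩⟩
  have hA : Nonempty (Fin N) := by
    by_contra hemp
    rw [not_nonempty_iff] at hemp
    have := IsSimpleModule.nontrivial Λᵐᵒᵖ T
    obtain ⟨x, hx⟩ := exists_ne (0 : T)
    exact hx (σ.injective (Subtype.ext (Subsingleton.elim _ _)))
  have hatom : ∀ x y, arrowMap e t b x = 0 → arrowMap e t b y = 0 → x ≠ 0 →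
      ∃ r : Λᵐᵒᵖ, y = r • x := by
    intro x y hx hy hx0
    have hx1 : σ.symm ⟨x, hx⟩ ≠ 0 := fun h0 =>
      hx0 (congrArg Subtype.val ((LinearEquiv.map_eq_zero_iff σ.symm).1 h0))
    obtain ⟨r, hr⟩ := IsSimpleModule.toSpanSingleton_surjective Λᵐᵒᵖ hx1 (σ.symm ⟨y, hy⟩)
    rw [LinearMap.toSpanSingleton_apply, ← map_smul] at hr
    exact ⟨r, (congrArg Subtype.val (σ.symm.injective hr)).symm⟩
  obtain ⟨α, -, hα⟩ := hb.links_of_ker h hs hatom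
  exact ⟨_, _, hα⟩

theorem conditionA_iff_exists_links (h : IsBasicSystem e) (hs : IsSymmetric K Λ) :
    ConditionA Λ ↔ ∃ (i j : ι) (a : Λ), Links K e i j a := by
  constructor
  · rintro ⟨S, _, _, T, _, _, hS, hST, hT⟩
    obtain ⟨i, f, hf, hker⟩ := h.exists_proj_to_simple (K := K) S
    exact ⟨i, h.exists_links_of_isNthSyzygy hs hf hker hST⟩
  · rintro ⟨i, j, a, ha⟩
    obtain ⟨z, hz⟩ := h.exists_isSocleGenerator hs i
    obtain ⟨z', hz'⟩ := h.exists_isSocleGenerator hs j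
    exact ⟨socProj K e i, _, _, socProj K e j, _, _, hz.isSimpleModule, ha.isNthSyzygy h hs,
      hz'.isSimpleModule⟩

/-- If all non-projective indecomposable modules have period dividing four, then links are
symmetric. -/
theorem Links.exists_symm (h : IsBasicSystem e) (hs : IsSymmetric K Λ)
    (h_period : ∀ (M : Type v) [AddCommGroup M] [Module Λᵐᵒᵖ M], Module.Finite Λᵐᵒᵖ M →
      IsIndecomposableModule Λᵐᵒᵖ M → ¬ Module.Projective Λᵐᵒᵖ M →
      ∃ n, HasPeriod Λᵐᵒᵖ M n ∧ n ∣ 4)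
    {i j : ι} {a : Λ} (ha : Links K e i j a) : ∃ b, Links K e j i b := by
  obtain ⟨z, hz⟩ := h.exists_isSocleGenerator hs i
  obtain ⟨z', hz'⟩ := h.exists_isSocleGenerator hs j
  have hsimple := hz.isSimpleModule
  have := hsimple.nontrivial
  have hfin : Module.Finite Λᵐᵒᵖ (socProj K e i) :=
    Module.Finite.of_surjective _ (IsSimpleModule.toSpanSingleton_surjective Λᵐᵒᵖ
      (m := (⟨z, hz.mem_socProj⟩ : socProj K e i))
      fun h0 => hz.ne_zero (congrArg Subtype.val h0))
  -- The syzygy of a projective module is zero, whereas `e_i (rad Λ)` contains `a ≠ 0`.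
  have hproj : ¬ Module.Projective Λᵐᵒᵖ (socProj K e i) := by
    intro hp
    have := (h.isSyzygy_radProj _ (projToSocle_surjective h hz)
      (projToSocle_eq_zero_iff h hz)).subsingleton_of_projective
    exact ha.ne_zero (congrArg Subtype.val (Subsingleton.elim
      (⟨a, ha.left, ha.mem⟩ : radProj K e i) 0))
  obtain ⟨n, hn, k, hk⟩ := h_period (socProj K e i) hfin
    ⟨inferInstance, fun A B hAB => (eq_bot_or_eq_top A).imp_right fun hA => by
      rw [hA] at hAB; exact eq_bot_of_top_isCompl hAB⟩ hproj
  have h4 : IsNthSyzygy Λᵐᵒᵖ (2 + 2) (socProj K e i) (socProj K e i) := by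
    have := hn.1.2.mul k
    rwa [← hk] at this
  -- Removing the first two steps of `Ω⁴(S_i) ≅ S_i` leaves `Ω²(S_j) ≅ S_i`.
  have h2 := (ha.isNthSyzygy h hs).of_add h4
  obtain ⟨k, b, hb⟩ := h.exists_links_of_isNthSyzygy hs (projToSocle_surjective h hz')
    (projToSocle_eq_zero_iff h hz') h2
  obtain ⟨σ⟩ := (hb.isNthSyzygy h hs).unique h2
  rw [h.eq_of_socProj_equiv hs σ] at hb
  exact ⟨b, hb⟩

end Simple

/-! ### Dimensions -/

section Dimensions

variable {K : Type u} [Field K] {Λ : Type v} [Ring Λ] [Algebra K Λ] [FiniteDimensional K Λ]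
  {ι : Type w} {e : ι → Λ}

instance (A : Submodule Λᵐᵒᵖ Λ) : Module.Finite K A :=
  inferInstanceAs (Module.Finite K (A.restrictScalars K))

variable [Fintype ι]

theorem IsArrowBasis.sum_finrank_proj (h : IsBasicSystem e) {A : Type*} [Fintype A] {t : A → ι}
    {a : A → Λ} {i : ι} (ha : IsArrowBasis K e i t a) :
    ∑ α, Module.finrank K (proj e (t α)) =
      Module.finrank K (radProj K e i) + Module.finrank K (LinearMap.ker (arrowMap e t a)) := by
  rw [← Module.finrank_pi_fintype,
    ← LinearMap.finrank_range_add_finrank_ker ((arrowMap e t a).restrictScalars K),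
    LinearMap.ker_restrictScalars, LinearMap.range_restrictScalars,
    show LinearMap.range (arrowMap e t a) = radProj K e i from
      Submodule.ext fun x => ha.mem_range_arrowMap h]
  rfl

variable [IsAlgClosed K]

theorem IsBasicSystem.finrank_proj (h : IsBasicSystem e) (hs : IsSymmetric K Λ) (i : ι) :
    Module.finrank K (proj e i) = Module.finrank K (radProj K e i) + 1 := by
  obtain ⟨z, hz⟩ := h.exists_isSocleGenerator hs i
  rw [← LinearMap.finrank_range_add_finrank_ker ((projToSocle hz).restrictScalars K),
    LinearMap.ker_restrictScalars, LinearMap.range_restrictScalars,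
    LinearMap.range_eq_top.2 (projToSocle_surjective h hz),
    ((radProjEquivKer h _ (projToSocle_eq_zero_iff h hz)).restrictScalars K).finrank_eq, add_comm]
  congr 1
  rw [Submodule.restrictScalars_top, finrank_top]
  exact hz.finrank_socProj

/-- The radical of `P_i` is `P_j` modulo its one-dimensional socle, and has codimension one in
`P_i`. -/
theorem Links.finrank_proj_eq (h : IsBasicSystem e) (hs : IsSymmetric K Λ) {i j : ι} {a : Λ}
    (ha : Links K e i j a) : Module.finrank K (proj e i) = Module.finrank K (proj e j) := by
  obtain ⟨z, hz⟩ := h.exists_isSocleGenerator hs j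
  obtain ⟨κ⟩ := ha.ker_equiv h hs
  have h1 := ha.isArrowBasis.sum_finrank_proj h
  rw [← (κ.restrictScalars K).finrank_eq, hz.finrank_socProj, Fin.sum_univ_one] at h1
  rw [h.finrank_proj hs, h1]

theorem Links.finrank_PPlus (h : IsBasicSystem e) {i j : QuiverOf K e} {a : Λ}
    (ha : Links K e i j a) :
    Module.finrank K (PPlus K e i) = Module.finrank K (P K e j) := by
  obtain ⟨α, hα, -⟩ := ha.exists_unique_star h
  have : Unique (Quiver.Star i) := ⟨⟨⟨j, α⟩⟩, hα⟩
  rw [Module.finrank_directSum, Fintype.sum_unique, hα default]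

theorem Links.finrank_PMinus (h : IsBasicSystem e) {i j : QuiverOf K e} {a : Λ}
    (ha : Links K e i j a) :
    Module.finrank K (PMinus K e j) = Module.finrank K (P K e i) := by
  obtain ⟨α, -, hα⟩ := ha.exists_unique_star h
  have : Unique (Quiver.Costar j) := ⟨⟨⟨i, α⟩⟩, hα⟩
  rw [Module.finrank_directSum, Fintype.sum_unique, hα default]

theorem Links.conditionC (h : IsBasicSystem e) (hs : IsSymmetric K Λ) {i j : ι} {a b : Λ}
    (ha : Links K e i j a) (hb : Links K e j i b) : ConditionC K e :=
  ⟨i, (ha.finrank_proj_eq h hs).trans (Links.finrank_PPlus h ha).symm,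
    (ha.finrank_proj_eq h hs).trans (Links.finrank_PMinus h hb).symm⟩

theorem ConditionC.exists_links (h : IsBasicSystem e) (hs : IsSymmetric K Λ)
    (hC : ConditionC K e) : ∃ (i j : ι) (a : Λ), Links K e i j a := by
  obtain ⟨i, hi, -⟩ := hC
  obtain ⟨b, hb⟩ := h.exists_isArrowBasis (K := K) i
  have h1 := hb.sum_finrank_proj h
  have h2 := h.finrank_proj hs i
  have h3 : Module.finrank K (PPlus K e i) =
      ∑ α : Quiver.Star i, Module.finrank K (proj e α.1) := Module.finrank_directSum _ _
  -- Rank-nullity: `dim P_i⁺` is `dim P_i - 1` plus the dimension of the kernel.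
  have h4 : Module.finrank K (LinearMap.ker (arrowMap e (fun s : Quiver.Star i => s.1) b)) = 1 := by
    have : Module.finrank K (P K e i) = Module.finrank K (proj e i) := rfl
    omega
  have hA : Nonempty (Quiver.Star i) := by
    by_contra hemp
    rw [not_nonempty_iff] at hemp
    rw [Finset.univ_eq_empty, Finset.sum_empty] at h3
    have : Module.finrank K (P K e i) = Module.finrank K (proj e i) := rfl
    omega
  obtain ⟨α, -, hα⟩ := hb.links_of_ker h hs fun x y hx hy hx0 => by
    obtain ⟨c, hc⟩ := exists_smul_eq_of_finrank_eq_one h4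
      (x := (⟨x, hx⟩ : LinearMap.ker (arrowMap e (fun s : Quiver.Star i => s.1) b)))
      (fun h0 => hx0 (congrArg Subtype.val h0)) ⟨y, hy⟩
    refine ⟨algebraMap K Λᵐᵒᵖ c, ?_⟩
    rw [algebraMap_smul]
    exact (congrArg Subtype.val hc).symm
  exact ⟨i, _, _, hα⟩

end Dimensions

/-! ### The shape of the quiver -/

section Shape

variable {K : Type u} [Field K] {Λ : Type v} [Ring Λ] [Algebra K Λ] {ι : Type w} {e : ι → Λ}
  {i j : ι} {a b : Λ}

theorem IsSymmetric.mul_mul_eq_zero_symm (hs : IsSymmetric K Λ) {x y : Λ}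
    (hxy : ∀ r, x * r * y = 0) (r : Λ) : y * r * x = 0 := by
  obtain ⟨φ, hφ, hn⟩ := hs
  refine hn _ fun b => ?_
  rw [mul_assoc, hφ, ← mul_assoc, hxy, zero_mul, map_zero]

variable [Fintype ι]

/-- The sum of the `e i` over `s` is a central idempotent, hence `1`. -/
theorem IsBasicSystem.eq_univ_of_mul_mul_eq_zero (h : IsBasicSystem e)
    (h_indec : IsIndecomposableRing Λ) {s : Finset ι} (hs : s.Nonempty)
    (h0 : ∀ i ∈ s, ∀ k ∉ s, ∀ x, e i * x * e k = 0 ∧ e k * x * e i = 0) (k : ι) : k ∈ s := by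
  classical
  have hidem : IsIdempotentElem (∑ i ∈ s, e i) := h.complete.isIdempotentElem_sum
  have hcomm : ∀ x, x * ∑ i ∈ s, e i = (∑ i ∈ s, e i) * x := by
    intro x
    have h1 : (∑ i ∈ s, e i) * x = ∑ i ∈ s, ∑ l ∈ s, e i * x * e l := by
      rw [Finset.sum_mul]
      refine Finset.sum_congr rfl fun i hi => ?_
      exact (h.mul_sum (e i * x)).symm.trans
        (Finset.sum_subset s.subset_univ fun l _ hl => (h0 i hi l hl x).1).symm
    have h2 : x * ∑ i ∈ s, e i = ∑ l ∈ s, ∑ i ∈ s, e i * x * e l := by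
      rw [Finset.mul_sum]
      refine Finset.sum_congr rfl fun l hl => ?_
      have := (h.sum_mul (x * e l)).symm
      simp only [← mul_assoc] at this
      exact this.trans (Finset.sum_subset s.subset_univ fun i _ hi => (h0 l hl i hi x).2).symm
    rw [h1, h2, Finset.sum_comm]
  by_contra hk
  rcases h_indec.2 _ (Subring.mem_center_iff.2 hcomm) hidem with h1 | h1
  · obtain ⟨i, hi⟩ := hs
    apply (h.primitive i).2.1
    rw [← h.complete.mul_sum_of_mem hi, h1, mul_zero]
  · apply (h.primitive k).2.1
    rw [← mul_one (e k), ← h1, h.complete.mul_sum_of_notMem hk]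

variable [FiniteDimensional K Λ]

/-- An element of `e_i Λ e_k` lies in the radical, so it is `a` times an element of `e_j Λ e_k`,
which in turn is `b` times one of `e_i Λ e_k`. Going back and forth pushes it into every power of
the radical. -/
theorem Links.mul_mul_eq_zero (h : IsBasicSystem e) (ha : Links K e i j a) (hb : Links K e j i b)
    {k : ι} (hi : k ≠ i) (hj : k ≠ j) (x : Λ) : e i * x * e k = 0 := by
  have base : ∀ {i : ι}, k ≠ i → ∀ x, e i * x * e k ∈ rad Λ K := fun hi x =>
    h.mem_rad_of_ne K hi (by simp only [← mul_assoc, h.idem]) (by simp only [mul_assoc, h.idem])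
  have step : ∀ {i j : ι} {a : Λ}, Links K e i j a → k ≠ i → ∀ n : ℕ,
      (∀ x, e j * x * e k ∈ (rad Λ K) ^ n) → ∀ x, e i * x * e k ∈ (rad Λ K) ^ (n + 1) := by
    intro i j a ha hi n hn x
    obtain ⟨y, hy⟩ := ha.gen _ (base hi x)
    have : e i * x * e k = a * (e j * y * e k) := by
      calc e i * x * e k = e i * (e i * x * e k) * e k := by
            simp only [← mul_assoc, h.idem]
            rw [mul_assoc _ (e k), h.idem]
        _ = a * (e j * y * e k) := by rw [hy]; simp only [← mul_assoc, ha.right]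
    rw [this, pow_succ']
    exact Submodule.mul_mem_mul ha.mem (hn y)
  have key : ∀ n : ℕ, (∀ x, e i * x * e k ∈ (rad Λ K) ^ (n + 1)) ∧
      ∀ x, e j * x * e k ∈ (rad Λ K) ^ (n + 1) := by
    intro n
    induction n with
    | zero =>
      rw [zero_add, pow_one]
      exact ⟨base hi, base hj⟩
    | succ n ih => exact ⟨step ha hi _ ih.2, step hb hj _ ih.1⟩
  obtain ⟨n, hn⟩ := rad_pow_eq_bot K Λ
  simpa [pow_succ, hn] using (key n).1 x

theorem Links.eq_or_eq (h : IsBasicSystem e) (hs : IsSymmetric K Λ)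
    (h_indec : IsIndecomposableRing Λ) (ha : Links K e i j a) (hb : Links K e j i b) (k : ι) :
    k = i ∨ k = j := by
  classical
  have := h.eq_univ_of_mul_mul_eq_zero h_indec (s := {i, j}) (Finset.insert_nonempty _ _)
    (fun l hl k hk x => by
      simp only [Finset.mem_insert, Finset.mem_singleton, not_or] at hl hk
      rcases hl with rfl | rfl
      · have := ha.mul_mul_eq_zero h hb hk.1 hk.2
        exact ⟨this x, hs.mul_mul_eq_zero_symm this x⟩
      · have := hb.mul_mul_eq_zero h ha hk.2 hk.1
        exact ⟨this x, hs.mul_mul_eq_zero_symm this x⟩) k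
  simpa using this

theorem Links.quiver_shape [IsAlgClosed K] (h : IsBasicSystem e) (hs : IsSymmetric K Λ)
    (h_indec : IsIndecomposableRing Λ) {i j : QuiverOf K e} (ha : Links K e i j a)
    (hb : Links K e j i b) : IsLoopQuiver (QuiverOf K e) ∨ IsTwoCycleQuiver (QuiverOf K e) := by
  have hk := ha.eq_or_eq h hs h_indec hb
  by_cases hij : i = j
  · subst hij
    exact Or.inl ⟨i, fun k => (hk k).elim id id, ha.nonempty_unique_hom h⟩
  · exact Or.inr ⟨i, j, hij, hk, ha.nonempty_unique_hom h, hb.nonempty_unique_hom h,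
      isEmpty_hom_of_finrank (ha.finrank_arrowSpace_left h hij),
      isEmpty_hom_of_finrank (hb.finrank_arrowSpace_left h (Ne.symm hij))⟩

end Shape

/-! ### Uniserial modules and finite representation type -/

section Serial

variable {K : Type u} [Field K] {R : Type v} [Ring R] [Algebra K R] {ι : Type w} [Fintype ι]
  {e : ι → R} {J : Submodule K R}

theorem isUniserial_of_forall_dvd {M : Type*} [AddCommGroup M] [Module R M]
    (h : ∀ x y : M, (∃ t : R, x = t • y) ∨ ∃ t : R, y = t • x) : IsUniserial R M := by
  intro A B
  by_contra! hAB
  obtain ⟨x, hxA, hxB⟩ := SetLike.not_le_iff_exists.1 hAB.1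
  obtain ⟨y, hyB, hyA⟩ := SetLike.not_le_iff_exists.1 hAB.2
  rcases h x y with ⟨t, rfl⟩ | ⟨t, rfl⟩
  · exact hxB (B.smul_mem t hyB)
  · exact hyA (A.smul_mem t hxA)

variable (K) in
/-- Idempotents with sum `1` such that every left ideal `R e_l` is local with radical `J e_l`,
which is generated by one element lying in some `e_m R`; here `J` is a nilpotent right ideal. -/
structure IsSerialSystem (e : ι → R) (J : Submodule K R) : Prop where
  sum_eq_one : ∑ l, e l = 1
  idem : ∀ l, e l * e l = e l
  scalar : ∀ l r, ∃ c : K, r * e l - c • e l ∈ J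
  mul_mem_right : ∀ r, ∀ x ∈ J, x * r ∈ J
  nilpotent : ∃ n, J ^ n = ⊥
  gen : ∀ l, ∃ m a, e m * a = a ∧ a ∈ J ∧ ∀ x ∈ J, ∃ y, x * e l = y * a

namespace IsSerialSystem

variable {M : Type*} [AddCommGroup M] [Module R M]

theorem sum_smul (h : IsSerialSystem K e J) (y : M) : ∑ l, e l • y = y := by
  rw [← Finset.sum_smul, h.sum_eq_one, one_smul]

/-- On `w` the element `r` acts as a scalar plus an element of the nilpotent `J`: a unit if the
scalar is nonzero. -/
theorem exists_smul_smul_eq_or (h : IsSerialSystem K e J) {l : ι} {w : M} (hw : e l • w = w)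
    (r : R) : (∃ s : R, s • r • w = w) ∨ ∃ s ∈ J, r • w = s • w := by
  obtain ⟨c, hc⟩ := h.scalar l r
  have hr : r • w = (algebraMap K R c + (r * e l - c • e l)) • w := by
    rw [Algebra.smul_def, add_smul, sub_smul, mul_smul, mul_smul, hw]
    abel
  by_cases hc0 : c = 0
  · right
    refine ⟨_, hc, ?_⟩
    rw [hr, hc0, map_zero, zero_add]
  · left
    obtain ⟨n, hn⟩ := h.nilpotent
    have hnil : IsNilpotent (c⁻¹ • (r * e l - c • e l)) := by
      refine ⟨n, ?_⟩
      have := Submodule.pow_mem_pow J (J.smul_mem c⁻¹ hc) n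
      rwa [hn, Submodule.mem_bot] at this
    have hunit : IsUnit (algebraMap K R c + (r * e l - c • e l)) := by
      have h1 : algebraMap K R c + (r * e l - c • e l) =
          algebraMap K R c * (1 + c⁻¹ • (r * e l - c • e l)) := by
        rw [mul_add, mul_one, ← Algebra.smul_def, smul_smul, mul_inv_cancel₀ hc0, one_smul]
      rw [h1]
      exact ((IsUnit.mk0 c hc0).map (algebraMap K R)).mul hnil.isUnit_one_add
    obtain ⟨u, hu⟩ := hunit
    refine ⟨↑u⁻¹, ?_⟩
    rw [hr, ← hu, smul_smul, Units.inv_mul, one_smul]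

/-- Induction on the power of `J` killing `w`. If neither multiple generates `R w`, both lie in `J w
= R (a w)`, and `a w` is killed by one power less. -/
theorem forall_dvd (h : IsSerialSystem K e J) {l : ι} {w : M} (hw : e l • w = w) (r s : R) :
    (∃ t : R, r • w = t • s • w) ∨ ∃ t : R, s • w = t • r • w := by
  have key : ∀ (n : ℕ) {l : ι} {w : M}, e l • w = w → (∀ x ∈ J ^ n, x • w = 0) → ∀ r s : R,
      (∃ t : R, r • w = t • s • w) ∨ ∃ t : R, s • w = t • r • w := by
    intro n
    induction n with
    | zero =>
      intro l w _ h0 r s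
      have := h0 1 (by rw [pow_zero]; exact Submodule.one_le.1 le_rfl)
      rw [one_smul] at this
      exact Or.inl ⟨0, by simp [this]⟩
    | succ n ih =>
      intro l w hw h0 r s
      rcases h.exists_smul_smul_eq_or hw r with ⟨t, ht⟩ | ⟨r', hr', hrw⟩
      · exact Or.inr ⟨s * t, by rw [mul_smul, ht]⟩
      rcases h.exists_smul_smul_eq_or hw s with ⟨t, ht⟩ | ⟨s', hs', hsw⟩
      · exact Or.inl ⟨r * t, by rw [mul_smul, ht]⟩
      obtain ⟨m, a, hma, haJ, hgen⟩ := h.gen l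
      have hJ : ∀ x ∈ J, ∃ y : R, x • w = y • a • w := by
        intro x hx
        obtain ⟨y, hy⟩ := hgen x hx
        exact ⟨y, by rw [← mul_smul, ← hy, mul_smul, hw]⟩
      obtain ⟨y, hy⟩ := hJ r' hr'
      obtain ⟨z, hz⟩ := hJ s' hs'
      rw [hrw, hsw, hy, hz]
      refine ih (w := a • w) (l := m) (by rw [← mul_smul, hma]) (fun x hx => ?_) y z
      rw [← mul_smul]
      apply h0
      rw [pow_succ]
      exact Submodule.mul_mem_mul hx haJ
  obtain ⟨n, hn⟩ := h.nilpotent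
  refine key n hw (fun x hx => ?_) r s
  rw [hn, Submodule.mem_bot] at hx
  rw [hx, zero_smul]

theorem forall_dvd_of_mem_span (h : IsSerialSystem K e J) {k : ι} {x y : R}
    (hx : x ∈ Submodule.span R {e k}) (hy : y ∈ Submodule.span R {e k}) :
    (∃ t : R, x = t • y) ∨ ∃ t : R, y = t • x := by
  obtain ⟨r, rfl⟩ := Submodule.mem_span_singleton.1 hx
  obtain ⟨s, rfl⟩ := Submodule.mem_span_singleton.1 hy
  exact h.forall_dvd (h.idem k) r s

/-- The element `q • m` lies at the bottom of the uniserial `R m`, and `G` does not kill it; so `G`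
is injective on `R m`. Moreover `G m` generates the image of `G`: otherwise `G m = G (x • y)` with
`x ∈ J`, and applying `q` gives zero. -/
theorem isCompl_span_ker (h : IsSerialSystem K e J) {G : M →ₗ[R] R} {k l p : ι}
    (hG : ∀ y, G y ∈ Submodule.span R {e k}) {m : M} {q : R} (hm : e l • m = m)
    (hq : e p * q = q) (hqJ : ∀ x ∈ J, ∀ y : M, q • x • y = 0)
    (hJq : ∀ x ∈ J, ∀ y : M, x • q • y = 0) (hne : G (q • m) ≠ 0) :
    IsCompl (Submodule.span R {m}) (LinearMap.ker G) := by
  constructor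
  · rw [Submodule.disjoint_def]
    intro y hy hyG
    obtain ⟨r, rfl⟩ := Submodule.mem_span_singleton.1 hy
    rw [LinearMap.mem_ker] at hyG
    rcases h.forall_dvd hm r q with ⟨t, ht⟩ | ⟨t, ht⟩
    · rcases h.exists_smul_smul_eq_or (w := q • m) (l := p) (by rw [← mul_smul, hq]) t with
        ⟨s, hs⟩ | ⟨s, hs, hst⟩
      · exact (hne (by rw [← hs, ← ht, map_smul, hyG, smul_zero])).elim
      · rw [ht, hst, hJq s hs]
    · exact (hne (by rw [ht, map_smul, hyG, smul_zero])).elim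
  · have hcyc : ∀ s y, e s • y = y → ∃ t : R, G y = t • G m := by
      intro s y hy
      rcases h.forall_dvd_of_mem_span (hG y) (hG m) with ht | ⟨t, ht⟩
      · exact ht
      · rcases h.exists_smul_smul_eq_or hy t with ⟨r, hr⟩ | ⟨r, hr, hrt⟩
        · exact ⟨r, by rw [ht, ← map_smul, ← map_smul, hr]⟩
        · refine (hne ?_).elim
          rw [map_smul, ht, ← map_smul, ← map_smul, hrt, hqJ r hr, map_zero]
    rw [codisjoint_iff, eq_top_iff]
    intro y _
    rw [← h.sum_smul y]
    refine sum_mem fun s _ => ?_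
    obtain ⟨t, ht⟩ := hcyc s (e s • y) (by rw [← mul_smul, h.idem])
    rw [← add_sub_cancel (t • m) (e s • y)]
    refine Submodule.add_mem_sup (Submodule.smul_mem _ _ (Submodule.mem_span_singleton_self m)) ?_
    rw [LinearMap.mem_ker, map_sub, ht, map_smul, sub_self]

/-- The symmetrizing form identifies the `K`-dual of `M` with `Hom_R(M, R)`: `F y` represents the
functional `r ↦ f (r • y)`, and uniqueness of representatives makes `F` linear. -/
theorem exists_linearMap_of_symmetric [FiniteDimensional K R] [Module K M] [IsScalarTower K R M]
    {φ : R →ₗ[K] K} (hφ : ∀ a b, φ (a * b) = φ (b * a)) (hn : ∀ a, (∀ b, φ (a * b) = 0) → a = 0)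
    (f : M →ₗ[K] K) : ∃ F : M →ₗ[R] R, ∀ r y, f (r • y) = φ (r * F y) := by
  choose F hF using fun y : M => exists_dual_representation hφ hn
    (f ∘ₗ (LinearMap.toSpanSingleton R M y).restrictScalars K)
  have hF' : ∀ r y, f (r • y) = φ (r * F y) := fun r y => hF y r
  have huniq : ∀ u v, (∀ r, φ (r * u) = φ (r * v)) → u = v := by
    intro u v huv
    rw [← sub_eq_zero]
    refine hn _ fun b => ?_
    rw [hφ, mul_sub, map_sub, huv, sub_self]
  refine ⟨⟨⟨F, fun x y => huniq _ _ fun r => ?_⟩, fun s y => huniq _ _ fun r => ?_⟩, hF'⟩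
  · rw [← hF', smul_add, map_add, hF', hF', mul_add, map_add]
  · rw [← hF', smul_smul, hF', RingHom.id_apply, smul_eq_mul, mul_assoc]

/-- Every indecomposable module over a symmetric serial algebra embeds into some `R e_k`. -/
theorem exists_injective (h : IsSerialSystem K e J) [FiniteDimensional K R]
    (hs : IsSymmetric K R) (hM : IsIndecomposableModule R M) :
    ∃ (k : ι) (G : M →ₗ[R] R), Function.Injective G ∧ ∀ y, G y ∈ Submodule.span R {e k} := by
  classical
  let _ : Module K M := Module.compHom M (algebraMap K R)
  have : IsScalarTower K R M := ⟨fun c r m => by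
    rw [Algebra.smul_def, mul_smul]
    rfl⟩
  have := hM.1
  obtain ⟨φ, hφ, hn⟩ := hs
  have hex : ∃ n, ∀ x ∈ J ^ n, ∀ y : M, x • y = 0 := by
    obtain ⟨n, hn⟩ := h.nilpotent
    refine ⟨n, fun x hx y => ?_⟩
    rw [hn, Submodule.mem_bot] at hx
    rw [hx, zero_smul]
  -- Here `n + 1` is the Loewy length of `M` with respect to `J`; an element `q` of `J ^ n` acting
  -- nontrivially reaches the last nonzero layer, so multiplying `q` by `J` on either side kills
  -- `M`.
  obtain ⟨n, hn1⟩ : ∃ n, Nat.find hex = n + 1 := by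
    refine Nat.exists_eq_succ_of_ne_zero fun h0 => ?_
    have h1 := Nat.find_spec hex
    rw [h0, pow_zero] at h1
    obtain ⟨y, hy⟩ := exists_ne (0 : M)
    exact hy (by rw [← one_smul R y, h1 1 (Submodule.one_le.1 le_rfl)])
  have hkill := Nat.find_spec hex
  rw [hn1] at hkill
  have hmin := Nat.find_min hex (m := n) (by omega)
  push Not at hmin
  obtain ⟨q, hq, y, hqy⟩ := hmin
  obtain ⟨f, hf⟩ : ∃ f : M →ₗ[K] K, f (q • y) ≠ 0 := by
    by_contra! hcon
    exact hqy ((Module.forall_dual_apply_eq_zero_iff K (q • y)).1 hcon)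
  obtain ⟨F, hF⟩ := exists_linearMap_of_symmetric hφ hn f
  obtain ⟨k, hk⟩ : ∃ k, F (q • y) * e k ≠ 0 := by
    by_contra! hcon
    apply hf
    rw [← one_smul R (q • y), hF, one_mul, ← mul_one (F _), ← h.sum_eq_one, Finset.mul_sum,
      Finset.sum_eq_zero fun k _ => hcon k, map_zero]
  let G : M →ₗ[R] R := LinearMap.mulRight R (e k) ∘ₗ F
  have hG : ∀ y, G y ∈ Submodule.span R {e k} :=
    fun y => Submodule.mem_span_singleton.2 ⟨F y, rfl⟩
  -- Replacing `y` by `e l • y` and then `q` by `e p * q` provides the idempotents that the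
  -- splitting lemma needs.
  obtain ⟨l, hl⟩ : ∃ l, G (q • e l • y) ≠ 0 := by
    by_contra! hcon
    apply hk
    change G (q • y) = 0
    rw [← h.sum_smul y, Finset.smul_sum, map_sum, Finset.sum_eq_zero fun l _ => hcon l]
  obtain ⟨p, hp⟩ : ∃ p, G ((e p * q) • e l • y) ≠ 0 := by
    by_contra! hcon
    apply hl
    rw [← h.sum_smul (q • e l • y), map_sum]
    exact Finset.sum_eq_zero fun p _ => by rw [← hcon p, mul_smul]
  have hcompl := h.isCompl_span_ker hG (l := l) (p := p) (by rw [← mul_smul, h.idem])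
    (by rw [← mul_assoc, h.idem]) (fun x hx z => ?_) (fun x hx z => ?_) hp
  · rcases hM.2 _ _ hcompl with h0 | h0
    · rw [Submodule.span_singleton_eq_bot] at h0
      exact (hp (by rw [h0, smul_zero, map_zero])).elim
    · exact ⟨k, G, LinearMap.ker_eq_bot.1 h0, hG⟩
  · rw [← mul_smul, mul_assoc, mul_smul, hkill (q * x), smul_zero]
    rw [pow_succ]
    exact Submodule.mul_mem_mul hq hx
  · rw [← mul_smul, ← mul_assoc]
    apply hkill
    rw [pow_succ']
    exact Submodule.mul_mem_mul (h.mul_mem_right _ _ hx) hq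

theorem isSerial (h : IsSerialSystem K e J) [FiniteDimensional K R] (hs : IsSymmetric K R) :
    IsSerial R := by
  intro M _ _ _ _ hM
  obtain ⟨k, G, hG, hGk⟩ := h.exists_injective hs hM
  refine isUniserial_of_forall_dvd fun x y => ?_
  refine (h.forall_dvd_of_mem_span (hGk x) (hGk y)).imp ?_ ?_
  · rintro ⟨t, ht⟩
    exact ⟨t, hG (by rw [ht, map_smul])⟩
  · rintro ⟨t, ht⟩
    exact ⟨t, hG (by rw [ht, map_smul])⟩

/-- These submodules form a chain, on which the dimension is injective and bounded. -/
theorem finite_submodules (h : IsSerialSystem K e J) [FiniteDimensional K R] (k : ι) :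
    {A : Submodule R R | A ≤ Submodule.span R {e k}}.Finite := by
  refine Set.Finite.of_finite_image (f := fun A : Submodule R R =>
    Module.finrank K (A.restrictScalars K)) ?_ ?_
  · refine (Set.finite_Iic (Module.finrank K R)).subset ?_
    rintro _ ⟨A, -, rfl⟩
    exact Submodule.finrank_le _
  · have aux : ∀ A B : Submodule R R, A ≤ B → Module.finrank K (A.restrictScalars K) =
        Module.finrank K (B.restrictScalars K) → A = B := fun A B hAB hfin =>
      Submodule.restrictScalars_injective K R R
        (Submodule.eq_of_le_of_finrank_eq (by simpa using hAB) hfin)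
    intro A hA B hB hAB
    have hle : A ≤ B ∨ B ≤ A := by
      by_contra! hcon
      obtain ⟨x, hxA, hxB⟩ := SetLike.not_le_iff_exists.1 hcon.1
      obtain ⟨y, hyB, hyA⟩ := SetLike.not_le_iff_exists.1 hcon.2
      rcases h.forall_dvd_of_mem_span (hA hxA) (hB hyB) with ⟨t, rfl⟩ | ⟨t, rfl⟩
      · exact hxB (B.smul_mem t hyB)
      · exact hyA (A.smul_mem t hxA)
    rcases hle with hle | hle
    · exact aux A B hle hAB
    · exact (aux B A hle hAB.symm).symm

/-- The representatives are the submodules of the `R e_k`; some may be decomposable, which does no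
harm. -/
theorem exists_finite_representatives (h : IsSerialSystem K e J) [FiniteDimensional K R]
    (hs : IsSymmetric K R) :
    ∃ (n : ℕ) (X : Fin n → ModuleCat.{v} R), ∀ (M : Type v) [AddCommGroup M] [Module R M],
      Module.Finite R M → IsIndecomposableModule R M → ∃ i, Nonempty (M ≃ₗ[R] X i) := by
  have hfin : (⋃ k, {A : Submodule R R | A ≤ Submodule.span R {e k}}).Finite :=
    Set.finite_iUnion h.finite_submodules
  obtain ⟨n, ⟨σ⟩⟩ := finite_iff_exists_equiv_fin.1 hfin.to_subtype
  refine ⟨n, fun i => ModuleCat.of R (σ.symm i).1, fun M _ _ _ hM => ?_⟩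
  obtain ⟨k, G, hG, hGk⟩ := h.exists_injective hs hM
  have hmem : LinearMap.range G ∈ ⋃ k, {A : Submodule R R | A ≤ Submodule.span R {e k}} := by
    rw [Set.mem_iUnion]
    refine ⟨k, ?_⟩
    rintro _ ⟨y, rfl⟩
    exact hGk y
  refine ⟨σ ⟨_, hmem⟩, ⟨(LinearEquiv.ofInjective G hG).trans (LinearEquiv.ofEq _ _ ?_)⟩⟩
  rw [Equiv.symm_apply_apply]

end IsSerialSystem

end Serial

/-! ### Serial systems on both sides from links -/

section Links

variable {K : Type u} [Field K] {Λ : Type v} [Ring Λ] [Algebra K Λ]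

theorem IsSymmetric.op (hs : IsSymmetric K Λ) : IsSymmetric K Λᵐᵒᵖ := by
  obtain ⟨φ, hφ, hn⟩ := hs
  refine ⟨φ ∘ₗ (MulOpposite.opLinearEquiv K).symm.toLinearMap, fun a b => hφ _ _, fun a ha => ?_⟩
  refine MulOpposite.unop_injective (hn _ fun b => ?_)
  rw [hφ]
  exact ha (MulOpposite.op b)

variable [FiniteDimensional K Λ] [IsAlgClosed K] {ι : Type w} [Fintype ι] {e : ι → Λ}

theorem IsBasicSystem.isSerialSystem (h : IsBasicSystem e)
    (hl : ∀ j, ∃ i a, Links K e i j a) : IsSerialSystem K e (rad Λ K) where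
  sum_eq_one := h.complete.complete
  idem := h.idem
  scalar l r := h.exists_mul_right_sub_mem_rad K l r
  mul_mem_right r _ hx := mul_mem_rad_right r hx
  nilpotent := rad_pow_eq_bot K Λ
  gen l := by
    obtain ⟨i, a, ha⟩ := hl l
    exact ⟨i, a, ha.left, ha.mem, ha.cogen⟩

/-- Taking for `J` the copy of `rad Λ` in the opposite algebra avoids identifying the Jacobson
radical of `Λᵐᵒᵖ`. Links starting at each vertex handle right modules; links ending there handle
left modules. -/
theorem IsBasicSystem.isSerialSystem_op (h : IsBasicSystem e)
    (hl : ∀ i, ∃ j a, Links K e i j a) :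
    IsSerialSystem K (fun i => MulOpposite.op (e i))
      ((rad Λ K).comap (MulOpposite.opLinearEquiv K).symm.toLinearMap) where
  sum_eq_one := by rw [← Finset.op_sum, h.complete.complete, MulOpposite.op_one]
  idem l := by rw [← MulOpposite.op_mul, h.idem]
  scalar l r := h.exists_mul_left_sub_mem_rad K l r.unop
  mul_mem_right r _ hx := mul_mem_rad_left (K := K) (Λ := Λ) r.unop hx
  nilpotent := by
    obtain ⟨n, hn⟩ := rad_pow_eq_bot K Λ
    refine ⟨n, ?_⟩
    rw [← Submodule.comap_unop_pow, hn]
    exact LinearEquiv.ker _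
  gen l := by
    obtain ⟨j, a, ha⟩ := hl l
    refine ⟨j, MulOpposite.op a, ?_, ha.mem, fun x hx => ?_⟩
    · rw [← MulOpposite.op_mul, ha.right]
    · obtain ⟨y, hy⟩ := ha.gen x.unop hx
      exact ⟨MulOpposite.op y, MulOpposite.unop_injective hy⟩

end Links

end RepFinSym

end

/-! ### The equivalences and their consequences -/

theorem mainTheorem1 {K : Type u} [Field K] [IsAlgClosed K]
    {Λ : Type v} [Ring Λ] [Algebra K Λ] [FiniteDimensional K Λ]
    {ι : Type w} [Fintype ι] (e : ι → Λ)
    (h_basic : RepFinSym.IsBasicSystem e)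
    (h_indec : RepFinSym.IsIndecomposableRing Λ)
    (h_symm : RepFinSym.IsSymmetric K Λ)
    (h_period : ∀ (M : Type v) [AddCommGroup M] [Module Λᵐᵒᵖ M], Module.Finite Λᵐᵒᵖ M →
      RepFinSym.IsIndecomposableModule Λᵐᵒᵖ M → ¬ Module.Projective Λᵐᵒᵖ M →
      ∃ n, RepFinSym.HasPeriod Λᵐᵒᵖ M n ∧ n ∣ 4) :
    [RepFinSym.ConditionA Λ,
      RepFinSym.ConditionB (RepFinSym.QuiverOf K e),
      RepFinSym.ConditionC K e].TFAE ∧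
    (RepFinSym.ConditionA Λ →
      (RepFinSym.IsLoopQuiver (RepFinSym.QuiverOf K e) ∨
        RepFinSym.IsTwoCycleQuiver (RepFinSym.QuiverOf K e)) ∧
      RepFinSym.IsNakayama Λ ∧ RepFinSym.HasFiniteType Λ) := by
  have hA := RepFinSym.conditionA_iff_exists_links (K := K) h_basic h_symm
  have hB := RepFinSym.conditionB_iff_exists_links (K := K) h_basic
  have hC : RepFinSym.ConditionC K e ↔ ∃ (i j : ι) (a : Λ), RepFinSym.Links K e i j a := by
    refine ⟨fun h => h.exists_links h_basic h_symm, ?_⟩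
    rintro ⟨i, j, a, ha⟩
    obtain ⟨b, hb⟩ := ha.exists_symm h_basic h_symm h_period
    exact ha.conditionC h_basic h_symm hb
  refine ⟨?_, fun h => ?_⟩
  · tfae_have 1 ↔ 2 := hA.trans hB.symm
    tfae_have 1 ↔ 3 := hA.trans hC.symm
    tfae_finish
  obtain ⟨i, j, a, ha⟩ := hA.1 h
  obtain ⟨b, hb⟩ := ha.exists_symm h_basic h_symm h_period
  have hl : RepFinSym.IsSerialSystem K e (RepFinSym.rad Λ K) :=
    h_basic.isSerialSystem fun k => by
      rcases ha.eq_or_eq h_basic h_symm h_indec hb k with rfl | rfl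
      exacts [⟨_, _, hb⟩, ⟨_, _, ha⟩]
  have hr := h_basic.isSerialSystem_op (K := K) fun k => by
    rcases ha.eq_or_eq h_basic h_symm h_indec hb k with rfl | rfl
    exacts [⟨_, _, ha⟩, ⟨_, _, hb⟩]
  exact ⟨RepFinSym.Links.quiver_shape h_basic h_symm h_indec ha hb,
    ⟨hl.isSerial h_symm, hr.isSerial h_symm.op⟩, hr.exists_finite_representatives h_symm.op⟩
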